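/- **Setting.** Let $X\in\mathbb{R}^{n\times p}$ be a fixed design, $g\in\mathbb{R}^n$ a mean vector (for instance $g=X\beta^0$), $\tau>0$, and $y\sim N(g,\tau^2 I_n)$. Let $A,B$ be non-empty disjoint sets with $A\cup B=\{1,\dots,n\}$ and sizes $n_A,n_B$. A selection algorithm $\hat M$ maps $y_A$ to a subset of $\{1,\dots,p\}$. Fix $M\subset\{1,\dots,p\}$ and $j\in M$ such that the Gram matrices $X_{A,M}^TX_{A,M}$ and $X_{B,M}^TX_{B,M}$ are invertible, and suppose that up to a Lebesgue null set $\{\hat M=M\}=\bigcup_s\{u\in\mathbb{R}^A: A_su\le b_s\}$, a finite or countable union of polyhedra. For $S\in\{A,B\}$ let $\eta_S^T$ be the row of $(X_{S,M}^TX_{S,M})^{-1}X_{S,M}^T$ belonging to $j$, and $\tau_S^2=\tau^2(X_{S,M}^TX_{S,M})^{-1}_{jj}$. Assume that both contrasts have the same mean $$\eta_A^Tg_A=\eta_B^Tg_B=:\beta_j^M$$ (true, for instance, if $g=X\beta^0$ and $M$ contains the support of $\beta^0$). The data carving estimator is $$\hat\beta_j=\tfrac1n\big[n_A\,\eta_A^Ty_A+n_B\,\eta_B^Ty_B\big].$$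 For a polyhedron $\{A_su\le b_s\}$ put $c=\eta_A/\|\eta_A\|^2$, $r(u)=u-c\,\eta_A^Tu$, $$V_s^-(u)=\max_{i:(A_sc)_i<0}\frac{(b_s-A_sr(u))_i}{(A_sc)_i},\qquad V_s^+(u)=\min_{i:(A_sc)_i>0}\frac{(b_s-A_sr(u))_i}{(A_sc)_i},$$ with $\max\emptyset=-\infty$ and $\min\emptyset=+\infty$. For $-\infty\le a<b\le+\infty$ and $\mu\in\mathbb{R}$ let $F_\mu^{a,b}$ be the CDF of the SNTN variable $\frac{n_B}{n}X_1+\frac{n_A}{n}X_2$, where $X_1\sim N(\mu,\tau_B^2)$ and $X_2$, which is $N(\mu,\tau_A^2)$ conditioned on $[a,b]$, are independent. **Theorem.** 1. *(The CDF.)* For all $a<b$, $\mu$ and $z$, with $\sigma_1^2=(n_B^2\tau_B^2+n_A^2\tau_A^2)/n^2$, $\sigma_2=\tau_A$, $\rho=n_A\sigma_2/(n\sigma_1)$, $\omega=(a-\mu)/\sigma_2$, $\delta=(b-\mu)/\sigma_2$, $$F_\mu^{a,b}(z)=\frac{B_\rho\big(\tfrac{z-\mu}{\sigma_1},\delta\big)-B_\rho\big(\tfrac{z-\mu}{\sigma_1},\omega\big)}{\Phi(\delta)-\Phi(\omega)},$$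 where $\Phi$ is the standard normal CDF and $B_\rho$ the CDF of the standard bivariate normal distribution with correlation $\rho$. 2. *(Monotonicity and unique roots.)* For all $a<b$ and $z$, the function $\mu\mapsto F_\mu^{a,b}(z)$ is strictly decreasing on $\mathbb{R}$, and for every $\alpha\in(0,1)$ the numbers $\sup\{\mu:F_\mu^{a,b}(z)\ge1-\alpha/2\}$ and $\inf\{\mu:F_\mu^{a,b}(z)\le\alpha/2\}$ are real and are the unique solutions $\mu$ of $F_\mu^{a,b}(z)=1-\alpha/2$ and $F_\mu^{a,b}(z)=\alpha/2$ respectively. 3. *(Exactness given the polyhedron.)* For every $s$ with $P(A_sy_A\le b_s)>0$, conditionally on $\{A_sy_A\le b_s\}$ and with $V^\pm=V_s^\pm(y_A)$: almost surely $V^-<V^+$; $$F_{\beta_j^M}^{V^-,V^+}(\hat\beta_j)\sim U(0,1);$$ and for every $\alpha\in(0,1)$ $$P\big(\beta_j^M\in[\hat\beta_j^-,\hat\beta_j^+]\big)=1-\alpha,\quad \hat\beta_j^-=\sup\{\mu:F_\mu^{V^-,V^+}(\hat\beta_j)\ge1-\alpha/2\},\quad \hat\beta_j^+=\inf\{\mu:F_\mu^{V^-,V^+}(\hat\beta_j)\le\alpha/2\}.$$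 4. *(Exactness given the selected model.)* If the polyhedra are pairwise disjoint up to null sets and $P(\hat M(y_A)=M)>0$, the same three assertions hold conditionally on $\{\hat M(y_A)=M\}$, with $V^\pm=V_{s}^\pm(y_A)$ for $s=\hat s(y_A)$ the index of a polyhedron that contains $y_A$. -/

import Mathlib

open MeasureTheory ProbabilityTheory
open scoped Matrix NNReal ENNReal

namespace Carving

noncomputable section

/-! ### The sum of a normal and a truncated normal -/

/-- The interval `{x ∈ ℝ : a ≤ x ≤ b}` with possibly infinite end points. -/
def eInterval (a b : EReal) : Set ℝ := {x : ℝ | a ≤ (x : EReal) ∧ (x : EReal) ≤ b}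

/-- `TN(μ, v, a, b)`: the law `N(μ, v)` conditioned on `[a, b]`. -/
def truncNormal (μ : ℝ) (v : ℝ≥0) (a b : EReal) : Measure ℝ :=
  cond (gaussianReal μ v) (eInterval a b)

/-- `SNTN(μ₁, v₁, μ₂, v₂, a, b, c₁, c₂)`: the law of `c₁ X₁ + c₂ X₂` for independent
`X₁ ∼ N(μ₁, v₁)` and `X₂ ∼ TN(μ₂, v₂, a, b)`. -/
def sntn (μ₁ : ℝ) (v₁ : ℝ≥0) (μ₂ : ℝ) (v₂ : ℝ≥0) (a b : EReal) (c₁ c₂ : ℝ) : Measure ℝ :=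
  ((gaussianReal μ₁ v₁).prod (truncNormal μ₂ v₂ a b)).map (fun q => c₁ * q.1 + c₂ * q.2)

/-- The cumulative distribution function of the SNTN distribution. -/
def sntnCDF (μ₁ : ℝ) (v₁ : ℝ≥0) (μ₂ : ℝ) (v₂ : ℝ≥0) (a b : EReal) (c₁ c₂ : ℝ) (z : ℝ) : ℝ :=
  (sntn μ₁ v₁ μ₂ v₂ a b c₁ c₂).real (Set.Iic z)

/-- The standard normal CDF `Φ`, extended to `±∞`. -/
def stdNormalCDF (x : EReal) : ℝ :=
  (gaussianReal 0 1).real {t : ℝ | (t : EReal) ≤ x}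

/-- The standard bivariate normal law with correlation `ρ`: the law of
`(ρ V + √(1 - ρ²) U, V)` for independent standard normal `U`, `V`. -/
def stdBivariateNormal (ρ : ℝ) : Measure (ℝ × ℝ) :=
  ((gaussianReal 0 1).prod (gaussianReal 0 1)).map
    (fun q => (ρ * q.2 + √(1 - ρ ^ 2) * q.1, q.2))

/-- The CDF `B_ρ(x₁, x₂)` of the standard bivariate normal law, with `x₂ = ±∞` allowed. -/
def bivariateNormalCDF (ρ x₁ : ℝ) (x₂ : EReal) : ℝ :=
  (stdBivariateNormal ρ).real {q : ℝ × ℝ | q.1 ≤ x₁ ∧ (q.2 : EReal) ≤ x₂}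

/-! ### Least squares on a part of the data -/

variable {n p : ℕ}

/-- `X_{S,M}`: the rows in `S` and the columns in `M` of the design matrix. -/
def subDesign (X : Matrix (Fin n) (Fin p) ℝ) (S : Finset (Fin n)) (M : Finset (Fin p)) :
    Matrix S M ℝ :=
  X.submatrix Subtype.val Subtype.val

/-- The Gram matrix `X_{S,M}ᵀ X_{S,M}`. -/
def gram (X : Matrix (Fin n) (Fin p) ℝ) (S : Finset (Fin n)) (M : Finset (Fin p)) :
    Matrix M M ℝ :=
  (subDesign X S M)ᵀ * subDesign X S M

/-- The contrast `η_{S,M_j}`: the row of `(X_{S,M}ᵀ X_{S,M})⁻¹ X_{S,M}ᵀ` that belongs to `j`. -/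
def contrast (X : Matrix (Fin n) (Fin p) ℝ) (S : Finset (Fin n)) (M : Finset (Fin p)) (j : M) :
    S → ℝ :=
  ((gram X S M)⁻¹ * (subDesign X S M)ᵀ) j

/-- `η_{S,M_j}ᵀ y_S`: the `j`-th coefficient in the regression of `y_S` on `X_{S,M}`. -/
def olsCoef (X : Matrix (Fin n) (Fin p) ℝ) (S : Finset (Fin n)) (M : Finset (Fin p)) (j : M)
    (y : Fin n → ℝ) : ℝ :=
  contrast X S M j ⬝ᵥ S.restrict y

/-- The data carving estimator `(n_A η_Aᵀ y_A + n_B η_Bᵀ y_B) / n`. -/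
def carveEstimator (X : Matrix (Fin n) (Fin p) ℝ) (SA SB : Finset (Fin n)) (M : Finset (Fin p))
    (j : M) (y : Fin n → ℝ) : ℝ :=
  ((SA.card : ℝ) * olsCoef X SA M j y + (SB.card : ℝ) * olsCoef X SB M j y) / (n : ℝ)

/-- The variance `τ² (X_{S,M}ᵀ X_{S,M})⁻¹_{jj}` of the `j`-th coefficient. -/
def coefVar (X : Matrix (Fin n) (Fin p) ℝ) (τ : ℝ) (S : Finset (Fin n)) (M : Finset (Fin p))
    (j : M) : ℝ :=
  τ ^ 2 * (gram X S M)⁻¹ j j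

/-- The SNTN CDF of data carving at the point `z`, as a function of the truncation points `a`, `b`
and of the common mean `μ` of the normal and the truncated normal component. -/
def carveCDF (X : Matrix (Fin n) (Fin p) ℝ) (τ : ℝ) (SA SB : Finset (Fin n))
    (M : Finset (Fin p)) (j : M) (a b : EReal) (μ z : ℝ) : ℝ :=
  sntnCDF μ (coefVar X τ SB M j).toNNReal μ (coefVar X τ SA M j).toNNReal a b
    ((SB.card : ℝ) / n) ((SA.card : ℝ) / n) z

/-! ### Polyhedral selection events and their truncation points -/

/-- The polyhedron `{u : A u ≤ b}`. -/
def polyhedron {S : Type*} [Fintype S] {m : ℕ} (A : Matrix (Fin m) S ℝ) (b : Fin m → ℝ) :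
    Set (S → ℝ) :=
  {u | ∀ i, (A *ᵥ u) i ≤ b i}

/-- The direction `c = η / ‖η‖²` along which `ηᵀ u` moves. -/
def direction {S : Type*} [Fintype S] (η : S → ℝ) : S → ℝ := (η ⬝ᵥ η)⁻¹ • η

/-- The component `u - c ηᵀ u` of `u` that is orthogonal to `η`. -/
def residual {S : Type*} [Fintype S] (η u : S → ℝ) : S → ℝ := u - (η ⬝ᵥ u) • direction η

/-- `V⁻(u) = max_{i : (A c)_i < 0} (b_i - (A r)_i) / (A c)_i` with `r` the residual of `u`;
it is `-∞` if there is no such `i`. -/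
def truncLower {S : Type*} [Fintype S] {m : ℕ} (η : S → ℝ) (A : Matrix (Fin m) S ℝ)
    (b : Fin m → ℝ) (u : S → ℝ) : EReal :=
  ⨆ (i : Fin m) (_ : (A *ᵥ direction η) i < 0),
    (((b i - (A *ᵥ residual η u) i) / (A *ᵥ direction η) i : ℝ) : EReal)

/-- `V⁺(u) = min_{i : (A c)_i > 0} (b_i - (A r)_i) / (A c)_i` with `r` the residual of `u`;
it is `+∞` if there is no such `i`. -/
def truncUpper {S : Type*} [Fintype S] {m : ℕ} (η : S → ℝ) (A : Matrix (Fin m) S ℝ)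
    (b : Fin m → ℝ) (u : S → ℝ) : EReal :=
  ⨅ (i : Fin m) (_ : 0 < (A *ᵥ direction η) i),
    (((b i - (A *ᵥ residual η u) i) / (A *ᵥ direction η) i : ℝ) : EReal)

/-! ### Confidence intervals and exactness -/

/-- `sup {μ : G μ ≥ 1 - α/2}`. -/
def ciLower (G : ℝ → ℝ) (α : ℝ) : ℝ := sSup {μ : ℝ | 1 - α / 2 ≤ G μ}

/-- `inf {μ : G μ ≤ α/2}`. -/
def ciUpper (G : ℝ → ℝ) (α : ℝ) : ℝ := sInf {μ : ℝ | G μ ≤ α / 2}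

/-- Exact inference for `β` under the (conditional) probability law `Q`, based on the estimator `T`
and the random truncation points `lo`, `up`; here `F a b μ z` is the CDF at `z` for the truncation
points `a`, `b` and the mean `μ`. -/
structure ExactInference {Ω : Type*} [MeasurableSpace Ω] (Q : Measure Ω)
    (F : EReal → EReal → ℝ → ℝ → ℝ) (T : Ω → ℝ) (lo up : Ω → EReal) (β : ℝ) : Prop where
  /-- Almost surely the truncation interval is not degenerate. -/
  lower_lt_upper : ∀ᵐ ω ∂Q, lo ω < up ω
  /-- The p-value at the true parameter is uniform on `(0, 1)`. -/
  uniform : pdf.IsUniform (fun ω => F (lo ω) (up ω) β (T ω)) (Set.Ioo 0 1) Q volume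
  /-- The confidence interval of level `1 - α` covers `β` with probability exactly `1 - α`. -/
  coverage : ∀ α ∈ Set.Ioo (0 : ℝ) 1,
    Q {ω | β ∈ Set.Icc (ciLower (fun μ => F (lo ω) (up ω) μ (T ω)) α)
      (ciUpper (fun μ => F (lo ω) (up ω) μ (T ω)) α)} = ENNReal.ofReal (1 - α)

end

end Carving

/-!
Given the residual `r` of `y_A` along `η_A`, the polyhedron `{u : A u ≤ b}` confines `η_Aᵀ y_A` to
`[V⁻, V⁺]`, and `V⁻`, `V⁺` depend on `r` alone. Since `η_Aᵀ y_A` is independent of `r` and of `y_B`,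
the carving estimator has the SNTN law with truncation points `V⁻`, `V⁺` given `r` and the
polyhedron, so its p-value at the true parameter is the probability integral transform of that law
and is uniform. Uniformity does not involve `r` or the polyhedron, and therefore survives mixing
over `r` and over disjoint polyhedra.

The p-value is strictly decreasing in the mean `μ` because a shift of `μ` tilts the untruncated law
exponentially, and it runs from `1` to `0`, so the events `β ∈ [β̂⁻, β̂⁺]` and
`p-value ∈ [α/2, 1 - α/2]` coincide.
-/

namespace Carving

open Filter Topology

/-! ### Conditional laws -/

section HasLawOn

variable {Ω 𝓧 𝓨 : Type*} [MeasurableSpace Ω] [MeasurableSpace 𝓧] [MeasurableSpace 𝓨]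
  {f : Ω → 𝓧} {U : Measure 𝓧} {P : Measure Ω} {s : Set Ω}

/-- `f` has law `U` under `P` conditioned on the event `s`. The condition is not normalised: it
is vacuous for a null event, and can therefore be integrated over a family of events. -/
def HasLawOn (f : Ω → 𝓧) (U : Measure 𝓧) (P : Measure Ω) (s : Set Ω) : Prop :=
  HasLaw f (P s • U) (P.restrict s)

namespace HasLawOn

lemma of_measure_eq_zero (hs : P s = 0) : HasLawOn f U P s := by
  rw [HasLawOn, hs, zero_smul, Measure.restrict_eq_zero.2 hs]
  exact ⟨aemeasurable_zero_measure, Measure.map_zero f⟩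

lemma congr (hf : HasLawOn f U P s) {g : Ω → 𝓧} (hg : g =ᵐ[P.restrict s] f) :
    HasLawOn g U P s :=
  HasLaw.congr hf hg

lemma congr_set (hf : HasLawOn f U P s) {t : Set Ω} (ht : t =ᵐ[P] s) : HasLawOn f U P t := by
  rwa [HasLawOn, measure_congr ht, Measure.restrict_congr_set ht]

lemma iUnion {ι : Type*} [Countable ι] {s : ι → Set Ω} (hs : ∀ i, NullMeasurableSet (s i) P)
    (hd : Pairwise (Function.onFun (AEDisjoint P) s)) (hf : ∀ i, HasLawOn f U P (s i)) :
    HasLawOn f U P (⋃ i, s i) := by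
  have hm : AEMeasurable f (P.restrict (⋃ i, s i)) :=
    aemeasurable_iUnion_iff.2 fun i => (hf i).aemeasurable
  refine ⟨hm, ?_⟩
  rw [Measure.restrict_iUnion_ae hd hs] at hm ⊢
  ext t ht
  simp only [Measure.map_sum hm, (hf _).map_eq, Measure.sum_apply _ ht, Measure.smul_apply,
    smul_eq_mul, ENNReal.tsum_mul_right, measure_iUnion₀ hd hs]

lemma preimage {κ : Measure 𝓨} {Z : Ω → 𝓨} (hZ : HasLaw Z κ P) {f : 𝓨 → 𝓧} {s : Set 𝓨}
    (hs : MeasurableSet s) (hf : HasLawOn f U κ s) :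
    HasLawOn (fun ω => f (Z ω)) U P (Z ⁻¹' s) := by
  have hZs : HasLaw Z (κ.restrict s) (P.restrict (Z ⁻¹' s)) :=
    ⟨hZ.aemeasurable.restrict, by
      rw [← hZ.map_eq, Measure.restrict_map_of_aemeasurable hZ.aemeasurable hs]⟩
  have h := HasLaw.fun_comp hf hZs
  rwa [← hZ.map_eq, Measure.map_apply_of_aemeasurable hZ.aemeasurable hs] at h

lemma prod {κ : Measure 𝓨} {Q : Measure Ω} [SFinite κ] [SFinite Q] {s : Set (𝓨 × Ω)}
    (hs : MeasurableSet s) {f : 𝓨 × Ω → 𝓧} (hf : Measurable f)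
    (h : ∀ y, HasLawOn (fun ω => f (y, ω)) U Q (Prod.mk y ⁻¹' s)) :
    HasLawOn f U (κ.prod Q) s := by
  refine ⟨hf.aemeasurable, Measure.ext fun t ht => ?_⟩
  have hslice : ∀ y, Q (Prod.mk y ⁻¹' (f ⁻¹' t ∩ s)) = Q (Prod.mk y ⁻¹' s) * U t := fun y => by
    have hy := congrArg (· t) (h y).map_eq
    have hfy : Measurable fun ω => f (y, ω) := hf.comp measurable_prodMk_left
    rwa [Measure.map_apply hfy ht, Measure.restrict_apply (hfy ht)] at hy
  rw [Measure.map_apply hf ht, Measure.restrict_apply (hf ht),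
    Measure.prod_apply ((hf ht).inter hs), Measure.smul_apply, Measure.prod_apply hs,
    smul_eq_mul, ← lintegral_mul_const _ (measurable_measure_prodMk_left hs)]
  exact lintegral_congr hslice

lemma hasLaw_cond [IsFiniteMeasure P] (hf : HasLawOn f U P s) (hs : P s ≠ 0) :
    HasLaw f U (cond P s) where
  aemeasurable := hf.aemeasurable.smul_measure _
  map_eq := by
    rw [ProbabilityTheory.cond, Measure.map_smul, hf.map_eq, smul_smul,
      ENNReal.inv_mul_cancel hs (measure_ne_top P s), one_smul]

end HasLawOn

end HasLawOn

/-! ### The probability integral transform -/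

section CDF

lemma cdf_eq_max_min {ν : Measure ℝ} (h : ∀ t ∈ Set.Ioo (0 : ℝ) 1, cdf ν t = t) (t : ℝ) :
    cdf ν t = max 0 (min t 1) := by
  have hmono := monotone_cdf ν
  rcases le_or_gt t 0 with h0 | h0
  · rw [max_eq_left ((min_le_left t 1).trans h0)]
    refine le_antisymm (le_of_forall_gt_imp_ge_of_dense fun s hs => ?_) (cdf_nonneg ν t)
    rcases lt_or_ge s 1 with h1 | h1
    · exact (hmono (h0.trans hs.le)).trans (h s ⟨hs, h1⟩).le
    · exact (cdf_le_one ν t).trans h1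
  rcases lt_or_ge t 1 with h1 | h1
  · rw [h t ⟨h0, h1⟩, min_eq_left h1.le, max_eq_right h0.le]
  · rw [min_eq_right h1, max_eq_right zero_le_one]
    refine le_antisymm (cdf_le_one ν t) (le_of_forall_lt_imp_le_of_dense fun s hs => ?_)
    rcases lt_or_ge 0 s with h2 | h2
    · exact (h s ⟨h2, hs⟩).ge.trans (hmono (hs.le.trans h1))
    · exact h2.trans (cdf_nonneg ν t)

variable (ν : Measure ℝ) [IsProbabilityMeasure ν]

lemma continuous_cdf [NullSingletonClass ν] : Continuous (cdf ν) := by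
  refine continuous_iff_continuousAt.2 fun x => ?_
  have hjump : cdf ν x - Function.leftLim (cdf ν) x ≤ 0 := by
    rw [← ENNReal.ofReal_eq_zero, ← StieltjesFunction.measure_singleton, measure_cdf,
      measure_singleton]
  have hle := (monotone_cdf ν).leftLim_le (le_refl x)
  rw [(monotone_cdf ν).continuousAt_iff_leftLim_eq_rightLim, (cdf ν).rightLim_eq]
  linarith

lemma strictMono_cdf [ν.IsOpenPosMeasure] : StrictMono (cdf ν) := by
  intro x y hxy
  have hpos : 0 < ν.real (Set.Ioc x y) := by
    refine (ENNReal.toReal_pos_iff).2 ⟨?_, measure_lt_top _ _⟩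
    exact (isOpen_Ioo.measure_pos ν (Set.nonempty_Ioo.2 hxy)).trans_le
      (measure_mono Set.Ioo_subset_Ioc_self)
  rw [cdf_eq_real, cdf_eq_real, ← Set.Iic_union_Ioc_eq_Iic hxy.le,
    measureReal_union (Set.Iic_disjoint_Ioc le_rfl) measurableSet_Ioc]
  linarith

lemma Ioo_subset_range_cdf [NullSingletonClass ν] : Set.Ioo 0 1 ⊆ Set.range (cdf ν) :=
  fun _ ht => mem_range_of_exists_le_of_exists_ge (continuous_cdf ν)
    ((((tendsto_cdf_atBot ν).eventually (gt_mem_nhds ht.1)).exists).imp fun _ => le_of_lt)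
    ((((tendsto_cdf_atTop ν).eventually (lt_mem_nhds ht.2)).exists).imp fun _ => le_of_lt)

lemma measureReal_cdf_le [NullSingletonClass ν] {t : ℝ} (ht : t ∈ Set.Ioo (0 : ℝ) 1) :
    ν.real {x | cdf ν x ≤ t} = t := by
  set S := {x | cdf ν x ≤ t} with hS
  have hne : S.Nonempty :=
    ((tendsto_cdf_atBot ν).eventually (gt_mem_nhds ht.1)).exists.imp fun _ => le_of_lt
  obtain ⟨y, hy⟩ := ((tendsto_cdf_atTop ν).eventually (lt_mem_nhds ht.2)).exists
  have hbdd : BddAbove S :=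
    ⟨y, fun x hx => ((monotone_cdf ν).reflect_lt ((hx : cdf ν x ≤ t).trans_lt hy)).le⟩
  have hsup : sSup S ∈ S :=
    (isClosed_le (continuous_cdf ν) continuous_const).csSup_mem hne hbdd
  have hIic : S = Set.Iic (sSup S) :=
    Set.ext fun x => ⟨fun hx => le_csSup hbdd hx, fun hx => (monotone_cdf ν hx).trans hsup⟩
  obtain ⟨x, rfl⟩ := Ioo_subset_range_cdf ν ht
  rw [hIic, ← cdf_eq_real]
  exact le_antisymm hsup (monotone_cdf ν (le_csSup hbdd (le_refl (cdf ν x))))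

instance isProbabilityMeasure_volume_restrict_Ioo :
    IsProbabilityMeasure ((volume : Measure ℝ).restrict (Set.Ioo 0 1)) := ⟨by simp⟩

lemma cdf_volume_restrict_Ioo {t : ℝ} (ht : t ∈ Set.Ioo (0 : ℝ) 1) :
    cdf ((volume : Measure ℝ).restrict (Set.Ioo 0 1)) t = t := by
  have hinter : Set.Iic t ∩ Set.Ioo 0 1 = Set.Ioc 0 t :=
    Set.ext fun x => ⟨fun hx => ⟨hx.2.1, hx.1⟩, fun hx => ⟨hx.2, hx.1, hx.2.trans_lt ht.2⟩⟩
  rw [cdf_eq_real, measureReal_restrict_apply measurableSet_Iic, hinter, Real.volume_real_Ioc,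
    sub_zero, max_eq_left ht.1.le]

lemma hasLaw_cdf [NullSingletonClass ν] :
    HasLaw (cdf ν) ((volume : Measure ℝ).restrict (Set.Ioo 0 1)) ν := by
  have hmeas : Measurable (cdf ν) := (continuous_cdf ν).measurable
  have : IsProbabilityMeasure (ν.map (cdf ν)) := Measure.isProbabilityMeasure_map hmeas.aemeasurable
  have hcdf : ∀ t ∈ Set.Ioo (0 : ℝ) 1, cdf (ν.map (cdf ν)) t = t := fun t ht => by
    rw [cdf_eq_real, map_measureReal_apply hmeas measurableSet_Iic]
    exact measureReal_cdf_le ν ht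
  refine ⟨hmeas.aemeasurable, Measure.eq_of_cdf _ _ (StieltjesFunction.ext fun t => ?_)⟩
  rw [cdf_eq_max_min hcdf, cdf_eq_max_min fun _ => cdf_volume_restrict_Ioo]

end CDF

/-! ### The sum of a normal and a truncated normal -/

section LinearCombination

variable (ν κ : Measure ℝ) {c₁ : ℝ} (c₂ : ℝ)

lemma measureReal_map_add_Iic [IsProbabilityMeasure ν] [IsFiniteMeasure κ] (hc₁ : 0 < c₁) (z : ℝ) :
    ((ν.prod κ).map fun q => c₁ * q.1 + c₂ * q.2).real (Set.Iic z) =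
      ∫ x, cdf ν ((z - c₂ * x) / c₁) ∂κ := by
  have hlin : Measurable fun q : ℝ × ℝ => c₁ * q.1 + c₂ * q.2 := by fun_prop
  have hslice : ∀ x, (fun w => (w, x)) ⁻¹' ((fun q : ℝ × ℝ => c₁ * q.1 + c₂ * q.2) ⁻¹' Set.Iic z) =
      Set.Iic ((z - c₂ * x) / c₁) := fun x => by
    ext w
    simp only [Set.mem_preimage, Set.mem_Iic, le_div_iff₀' hc₁, le_sub_iff_add_le]
  have hs := hlin (measurableSet_Iic (a := z))
  rw [map_measureReal_apply hlin measurableSet_Iic, Measure.real, Measure.prod_apply_symm hs,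
    ← integral_toReal (measurable_measure_prodMk_right hs).aemeasurable
      (ae_of_all _ fun _ => measure_lt_top _ _)]
  simp only [hslice, cdf_eq_real, Measure.real]

lemma nullSingletonClass_map_add [SFinite ν] [SFinite κ] [NullSingletonClass ν] (hc₁ : c₁ ≠ 0) :
    NullSingletonClass ((ν.prod κ).map fun q => c₁ * q.1 + c₂ * q.2) where
  measure_singleton z := by
    have hlin : Measurable fun q : ℝ × ℝ => c₁ * q.1 + c₂ * q.2 := by fun_prop
    rw [Measure.map_apply hlin (measurableSet_singleton z),
      Measure.prod_apply_symm (hlin (measurableSet_singleton z))]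
    refine lintegral_eq_zero_of_ae_eq_zero (ae_of_all _ fun x => ?_)
    refine Set.Subsingleton.measure_zero (fun w hw w' hw' => mul_left_cancel₀ hc₁ ?_) ν
    simp only [Set.mem_preimage, Set.mem_singleton_iff] at hw hw'
    linarith

end LinearCombination

lemma measurableSet_mem_eInterval {α : Type*} [MeasurableSpace α] {lo up : α → EReal} {f : α → ℝ}
    (hlo : Measurable lo) (hup : Measurable up) (hf : Measurable f) :
    MeasurableSet {x | f x ∈ eInterval (lo x) (up x)} :=
  (measurableSet_le hlo hf.coe_real_ereal).inter (measurableSet_le hf.coe_real_ereal hup)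

lemma measurableSet_eInterval (a b : EReal) : MeasurableSet (eInterval a b) :=
  measurableSet_mem_eInterval measurable_const measurable_const measurable_id

section Gaussian

variable (μ : ℝ) {v : ℝ≥0} (hv : v ≠ 0) {a b : EReal}
include hv

lemma isOpenPosMeasure_gaussianReal : (gaussianReal μ v).IsOpenPosMeasure :=
  (gaussianReal_absolutelyContinuous' μ hv).isOpenPosMeasure

lemma gaussianReal_eInterval_ne_zero (hab : a < b) : gaussianReal μ v (eInterval a b) ≠ 0 := by
  have := isOpenPosMeasure_gaussianReal μ hv
  obtain ⟨x, hax, hxb⟩ := EReal.lt_iff_exists_real_btwn.1 hab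
  obtain ⟨y, hxy, hyb⟩ := EReal.lt_iff_exists_real_btwn.1 hxb
  have hsub : Set.Ioo x y ⊆ eInterval a b := fun t ht =>
    ⟨hax.le.trans (EReal.coe_le_coe_iff.2 ht.1.le), (EReal.coe_le_coe_iff.2 ht.2.le).trans hyb.le⟩
  exact ((isOpen_Ioo.measure_pos _ (Set.nonempty_Ioo.2 (EReal.coe_lt_coe_iff.1 hxy))).trans_le
    (measure_mono hsub)).ne'

lemma gaussianReal_eInterval_eq_zero (hba : b ≤ a) : gaussianReal μ v (eInterval a b) = 0 := by
  have := nullSingletonClass_gaussianReal (μ := μ) hv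
  refine Set.Subsingleton.measure_zero (fun x hx y hy => ?_) _
  exact le_antisymm (EReal.coe_le_coe_iff.1 ((hx.2.trans hba).trans hy.1))
    (EReal.coe_le_coe_iff.1 ((hy.2.trans hba).trans hx.1))

lemma isProbabilityMeasure_truncNormal (hab : a < b) :
    IsProbabilityMeasure (truncNormal μ v a b) :=
  cond_isProbabilityMeasure (gaussianReal_eInterval_ne_zero μ hv hab)

lemma isProbabilityMeasure_sntn (μ₁ : ℝ) (v₁ : ℝ≥0) (hab : a < b) (c₁ c₂ : ℝ) :
    IsProbabilityMeasure (sntn μ₁ v₁ μ v a b c₁ c₂) := by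
  have := isProbabilityMeasure_truncNormal μ hv hab
  exact Measure.isProbabilityMeasure_map (by fun_prop)

lemma sntnCDF_eq_cdf (μ₁ : ℝ) (v₁ : ℝ≥0) (hab : a < b) (c₁ c₂ : ℝ) :
    sntnCDF μ₁ v₁ μ v a b c₁ c₂ = cdf (sntn μ₁ v₁ μ v a b c₁ c₂) := by
  have := isProbabilityMeasure_sntn μ hv μ₁ v₁ hab c₁ c₂
  ext z
  rw [cdf_eq_real, sntnCDF]

end Gaussian

section SNTN

variable (μ₁ : ℝ) (v₁ : ℝ≥0) (μ₂ : ℝ) (v₂ : ℝ≥0) (a b : EReal) (c₁ c₂ : ℝ)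

instance isFiniteMeasure_truncNormal : IsFiniteMeasure (truncNormal μ₂ v₂ a b) := by
  unfold truncNormal
  infer_instance

lemma smul_truncNormal :
    gaussianReal μ₂ v₂ (eInterval a b) • truncNormal μ₂ v₂ a b =
      (gaussianReal μ₂ v₂).restrict (eInterval a b) := by
  rcases eq_or_ne (gaussianReal μ₂ v₂ (eInterval a b)) 0 with h | h
  · rw [h, zero_smul, Measure.restrict_eq_zero.2 h]
  · rw [truncNormal, ProbabilityTheory.cond, smul_smul, ENNReal.mul_inv_cancel h
      (measure_ne_top _ _), one_smul]

lemma smul_sntn :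
    gaussianReal μ₂ v₂ (eInterval a b) • sntn μ₁ v₁ μ₂ v₂ a b c₁ c₂ =
      (((gaussianReal μ₁ v₁).prod (gaussianReal μ₂ v₂)).restrict
        (Set.univ ×ˢ eInterval a b)).map (fun q => c₁ * q.1 + c₂ * q.2) := by
  rw [sntn, ← Measure.map_smul, ← Measure.prod_smul_right, smul_truncNormal,
    ← Measure.prod_restrict, Measure.restrict_univ]

variable {v₁ v₂ c₁} in
lemma hasLawOn_sntnCDF (hv₁ : v₁ ≠ 0) (hv₂ : v₂ ≠ 0) (hc₁ : c₁ ≠ 0) :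
    HasLawOn (fun q : ℝ × ℝ => sntnCDF μ₁ v₁ μ₂ v₂ a b c₁ c₂ (c₁ * q.1 + c₂ * q.2))
      (volume.restrict (Set.Ioo 0 1)) ((gaussianReal μ₁ v₁).prod (gaussianReal μ₂ v₂))
      (Set.univ ×ˢ eInterval a b) := by
  have hprob : ((gaussianReal μ₁ v₁).prod (gaussianReal μ₂ v₂)) (Set.univ ×ˢ eInterval a b) =
      gaussianReal μ₂ v₂ (eInterval a b) := by
    rw [Measure.prod_prod, measure_univ, one_mul]
  rcases le_or_gt b a with hba | hab
  · exact .of_measure_eq_zero (hprob.trans (gaussianReal_eInterval_eq_zero μ₂ hv₂ hba))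
  have := isProbabilityMeasure_sntn μ₂ hv₂ μ₁ v₁ hab c₁ c₂
  have := nullSingletonClass_gaussianReal (μ := μ₁) hv₁
  have : NullSingletonClass (sntn μ₁ v₁ μ₂ v₂ a b c₁ c₂) := nullSingletonClass_map_add _ _ c₂ hc₁
  have hcdf := hasLaw_cdf (sntn μ₁ v₁ μ₂ v₂ a b c₁ c₂)
  refine HasLaw.fun_comp (Y := sntnCDF μ₁ v₁ μ₂ v₂ a b c₁ c₂)
    (μ := gaussianReal μ₂ v₂ (eInterval a b) • sntn μ₁ v₁ μ₂ v₂ a b c₁ c₂) ?_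
    ⟨by fun_prop, (smul_sntn μ₁ v₁ μ₂ v₂ a b c₁ c₂).symm⟩
  rw [sntnCDF_eq_cdf μ₂ hv₂ μ₁ v₁ hab]
  exact ⟨hcdf.aemeasurable.smul_measure _, by rw [Measure.map_smul, hcdf.map_eq, hprob]⟩

variable {c₁} in
lemma sntnCDF_eq_integral (hc₁ : 0 < c₁) (z : ℝ) :
    sntnCDF μ₁ v₁ μ₂ v₂ a b c₁ c₂ z =
      ∫ x, cdf (gaussianReal μ₁ v₁) ((z - c₂ * x) / c₁) ∂(truncNormal μ₂ v₂ a b) :=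
  measureReal_map_add_Iic _ _ c₂ hc₁ z

lemma sntnCDF_eq_div (z : ℝ) :
    sntnCDF μ₁ v₁ μ₂ v₂ a b c₁ c₂ z =
      ((gaussianReal μ₁ v₁).prod (gaussianReal μ₂ v₂)).real
        {q | c₁ * q.1 + c₂ * q.2 ≤ z ∧ q.2 ∈ eInterval a b} /
      (gaussianReal μ₂ v₂).real (eInterval a b) := by
  have hlin : Measurable fun q : ℝ × ℝ => c₁ * q.1 + c₂ * q.2 := by fun_prop
  have hpre : (fun q : ℝ × ℝ => c₁ * q.1 + c₂ * q.2) ⁻¹' Set.Iic z ∩ Set.univ ×ˢ eInterval a b =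
      {q | c₁ * q.1 + c₂ * q.2 ≤ z ∧ q.2 ∈ eInterval a b} := by
    ext q
    simp
  have hprod : (gaussianReal μ₁ v₁).prod ((gaussianReal μ₂ v₂).restrict (eInterval a b)) =
      ((gaussianReal μ₁ v₁).prod (gaussianReal μ₂ v₂)).restrict (Set.univ ×ˢ eInterval a b) := by
    rw [← Measure.prod_restrict, Measure.restrict_univ]
  rw [sntnCDF, sntn, map_measureReal_apply hlin measurableSet_Iic, truncNormal,
    ProbabilityTheory.cond, Measure.prod_smul_right, measureReal_ennreal_smul_apply, hprod,
    measureReal_restrict_apply (hlin measurableSet_Iic), hpre, ENNReal.toReal_inv,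
    ← measureReal_def, div_eq_inv_mul]

lemma measurable_sntnCDF_comp {α : Type*} [MeasurableSpace α] {lo up : α → EReal} {T : α → ℝ}
    (hlo : Measurable lo) (hup : Measurable up) (hT : Measurable T) :
    Measurable fun x => sntnCDF μ₁ v₁ μ₂ v₂ (lo x) (up x) c₁ c₂ (T x) := by
  have hsum : MeasurableSet {x : α × ℝ × ℝ | c₁ * x.2.1 + c₂ * x.2.2 ≤ T x.1} :=
    measurableSet_le (by fun_prop) (by fun_prop)
  have hmem : MeasurableSet {x : α × ℝ × ℝ | x.2.2 ∈ eInterval (lo x.1) (up x.1)} :=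
    measurableSet_mem_eInterval (by fun_prop) (by fun_prop) (by fun_prop)
  have hmem' : MeasurableSet {x : α × ℝ | x.2 ∈ eInterval (lo x.1) (up x.1)} :=
    measurableSet_mem_eInterval (by fun_prop) (by fun_prop) measurable_snd
  simp only [sntnCDF_eq_div]
  exact (measurable_measure_prodMk_left (hsum.inter hmem)).ennreal_toReal.div
    (measurable_measure_prodMk_left hmem').ennreal_toReal

end SNTN

/-! ### Exponential tilting -/

section Tilting

variable {Ω : Type*} [MeasurableSpace Ω]

lemma measureReal_tilted (ν : Measure Ω) [SFinite ν] (f : Ω → ℝ) (t : Set Ω) :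
    (ν.tilted f).real t = (∫ x in t, Real.exp (f x) ∂ν) / ∫ x, Real.exp (f x) ∂ν := by
  rw [Measure.real, tilted_apply_eq_ofReal_integral, integral_div, ENNReal.toReal_ofReal]
  positivity

lemma cond_tilted {ν : Measure Ω} [IsFiniteMeasure ν] {f : Ω → ℝ}
    (hf : Integrable (fun x => Real.exp (f x)) ν) {s : Set Ω} (hs : MeasurableSet s)
    (hνs : ν s ≠ 0) :
    cond (ν.tilted f) s = (cond ν s).tilted f := by
  have : NeZero ν := ⟨fun h => hνs (by simp [h])⟩
  refine Measure.ext fun t ht => (measureReal_eq_measureReal_iff).1 ?_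
  rw [Measure.real, cond_apply hs, ENNReal.toReal_mul, ENNReal.toReal_inv, ← Measure.real,
    ← Measure.real, measureReal_tilted, measureReal_tilted, measureReal_tilted,
    ProbabilityTheory.cond, Measure.restrict_smul, Measure.restrict_restrict ht, Set.inter_comm t,
    integral_smul_measure, integral_smul_measure, smul_eq_mul, smul_eq_mul,
    mul_div_mul_left _ _ (ENNReal.toReal_ne_zero.2 ⟨ENNReal.inv_ne_zero.2 (measure_ne_top ν s),
      ENNReal.inv_ne_top.2 hνs⟩), ← div_eq_inv_mul,
    div_div_div_cancel_right₀ (integral_exp_pos hf).ne']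

lemma gaussianReal_tilted (μ : ℝ) {v : ℝ≥0} (hv : v ≠ 0) (t : ℝ) :
    (gaussianReal μ v).tilted (t * ·) = gaussianReal (μ + v * t) v := by
  have hv' : (v : ℝ) ≠ 0 := NNReal.coe_ne_zero.2 hv
  have hmgf : ∫ x, Real.exp (t * x) ∂(gaussianReal μ v) = Real.exp (μ * t + v * t ^ 2 / 2) :=
    mgf_gaussianReal (X := id) Measure.map_id t
  rw [Measure.tilted, hmgf, gaussianReal_of_var_ne_zero _ hv, gaussianReal_of_var_ne_zero _ hv,
    ← withDensity_mul _ (measurable_gaussianPDF _ _) (by fun_prop)]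
  congr 1
  ext x
  rw [Pi.mul_apply, gaussianPDF, gaussianPDF, ← ENNReal.ofReal_mul (gaussianPDFReal_nonneg _ _ _),
    gaussianPDFReal, gaussianPDFReal, mul_assoc, ← Real.exp_sub, ← Real.exp_add]
  congr 3
  field_simp
  ring

/-- Chebyshev's integral inequality. -/
lemma integral_mul_le_mul_integral_of_antitone {ν : Measure ℝ} [IsProbabilityMeasure ν]
    {f g : ℝ → ℝ} (hf : Antitone f) (hg : Monotone g) (hfi : Integrable f ν)
    (hgi : Integrable g ν) (hfg : Integrable (fun x => f x * g x) ν) :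
    ∫ x, f x * g x ∂ν ≤ (∫ x, f x ∂ν) * ∫ x, g x ∂ν := by
  have hle : ∫ q, (f q.1 - f q.2) * (g q.1 - g q.2) ∂(ν.prod ν) ≤ 0 := by
    refine integral_nonpos fun q => ?_
    rcases le_total q.1 q.2 with h | h
    · exact mul_nonpos_of_nonneg_of_nonpos (sub_nonneg.2 (hf h)) (sub_nonpos.2 (hg h))
    · exact mul_nonpos_of_nonpos_of_nonneg (sub_nonpos.2 (hf h)) (sub_nonneg.2 (hg h))
  have hexpand : ∀ q : ℝ × ℝ, (f q.1 - f q.2) * (g q.1 - g q.2) =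
      (f q.1 * g q.1 + f q.2 * g q.2) - (f q.1 * g q.2 + g q.1 * f q.2) := fun q => by ring
  have hdiag := (hfg.comp_fst ν).add (hfg.comp_snd ν)
  have hcross := (hfi.mul_prod (ν := ν) hgi).add (hgi.mul_prod (ν := ν) hfi)
  simp only [hexpand] at hle
  rw [integral_sub (by exact hdiag) (by exact hcross),
    integral_add (hfg.comp_fst ν) (hfg.comp_snd ν),
    integral_add (hfi.mul_prod hgi) (hgi.mul_prod hfi), integral_fun_fst (fun x => f x * g x),
    integral_fun_snd (fun x => f x * g x), integral_prod_mul, integral_prod_mul, probReal_univ,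
    one_smul] at hle
  linarith

lemma integral_tilted_le_of_antitone {ν : Measure ℝ} [IsProbabilityMeasure ν] {f g : ℝ → ℝ}
    (hf : Antitone f) (hfi : Integrable f ν) (hg : Monotone g)
    (hgi : Integrable (fun x => Real.exp (g x)) ν)
    (hfg : Integrable (fun x => f x * Real.exp (g x)) ν) :
    ∫ x, f x ∂(ν.tilted g) ≤ ∫ x, f x ∂ν := by
  have h := integral_mul_le_mul_integral_of_antitone hf (Real.exp_monotone.comp hg) hfi hgi hfg
  simp only [integral_tilted, smul_eq_mul, div_mul_eq_mul_div, integral_div]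
  rw [div_le_iff₀ (integral_exp_pos hgi)]
  simpa only [mul_comm, Function.comp_apply] using h

lemma continuous_integral_mul_exp {T : Type*} [TopologicalSpace T] [FirstCountableTopology T]
    {ν : Measure Ω} {X : Ω → ℝ}
    (hX : ∀ t, Integrable (fun ω => Real.exp (t * X ω)) ν) {θ : T → ℝ} (hθ : Continuous θ)
    {F : T → Ω → ℝ} {C : ℝ} (hFm : ∀ t, AEStronglyMeasurable (F t) ν)
    (hFC : ∀ t ω, ‖F t ω‖ ≤ C) (hFc : ∀ ω, Continuous fun t => F t ω) :
    Continuous fun t => ∫ ω, Real.exp (θ t * X ω) * F t ω ∂ν := by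
  refine continuous_iff_continuousAt.2 fun t₀ => continuousAt_of_dominated
    (bound := fun ω => Real.exp ((|θ t₀| + 1) * |X ω|) * C)
    (Eventually.of_forall fun t => (hX _).aestronglyMeasurable.mul (hFm t)) ?_
    ((integrable_exp_mul_abs (hX _) (hX _)).mul_const C)
    (ae_of_all _ fun ω => Continuous.continuousAt (by have := hFc ω; fun_prop))
  filter_upwards [hθ.abs.continuousAt.eventually_lt_const (lt_add_one |θ t₀|)] with t ht
  refine ae_of_all _ fun ω => ?_
  rw [norm_mul, Real.norm_of_nonneg (Real.exp_nonneg _)]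
  refine mul_le_mul (Real.exp_le_exp.2 ?_) (hFC t ω) (norm_nonneg _) (Real.exp_nonneg _)
  calc θ t * X ω ≤ |θ t * X ω| := le_abs_self _
    _ = |θ t| * |X ω| := abs_mul _ _
    _ ≤ (|θ t₀| + 1) * |X ω| := by gcongr

lemma continuous_integral_tilted {T : Type*} [TopologicalSpace T] [FirstCountableTopology T]
    {ν : Measure Ω} [NeZero ν] {X : Ω → ℝ}
    (hX : ∀ t, Integrable (fun ω => Real.exp (t * X ω)) ν) {θ : T → ℝ} (hθ : Continuous θ)
    {F : T → Ω → ℝ} {C : ℝ} (hFm : ∀ t, AEStronglyMeasurable (F t) ν)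
    (hFC : ∀ t ω, ‖F t ω‖ ≤ C) (hFc : ∀ ω, Continuous fun t => F t ω) :
    Continuous fun t => ∫ ω, F t ω ∂(ν.tilted fun ω => θ t * X ω) := by
  simp only [integral_tilted, smul_eq_mul, div_mul_eq_mul_div, integral_div]
  exact (continuous_integral_mul_exp hX hθ hFm hFC hFc).div ((continuous_mgf hX).comp hθ)
    fun t => (integral_exp_pos (hX _)).ne'

end Tilting

section TruncNormal

variable {v : ℝ≥0} (hv : v ≠ 0) {a b : EReal} (hab : a < b)
include hv hab

lemma integrable_exp_truncNormal (μ t : ℝ) :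
    Integrable (fun x => Real.exp (t * x)) (truncNormal μ v a b) :=
  (integrable_exp_mul_gaussianReal t).integrableOn.smul_measure
    (ENNReal.inv_ne_top.2 (gaussianReal_eInterval_ne_zero μ hv hab))

lemma truncNormal_tilted (μ μ' : ℝ) :
    (truncNormal μ v a b).tilted (fun x => (μ' - μ) / v * x) = truncNormal μ' v a b := by
  have hv' : (v : ℝ) ≠ 0 := NNReal.coe_ne_zero.2 hv
  rw [truncNormal, ← cond_tilted (integrable_exp_mul_gaussianReal _) (measurableSet_eInterval a b)
    (gaussianReal_eInterval_ne_zero μ hv hab), gaussianReal_tilted μ hv, mul_div_cancel₀ _ hv',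
    add_sub_cancel, truncNormal]

lemma antitone_integral_truncNormal {f : ℝ → ℝ} (hf : Antitone f) {C : ℝ} (hC : ∀ x, ‖f x‖ ≤ C) :
    Antitone fun μ => ∫ x, f x ∂(truncNormal μ v a b) := by
  intro μ μ' hμ
  have := isProbabilityMeasure_truncNormal μ hv hab
  have hslope : 0 ≤ (μ' - μ) / v := div_nonneg (sub_nonneg.2 hμ) v.coe_nonneg
  have hfm := hf.measurable.aestronglyMeasurable (μ := truncNormal μ v a b)
  have hexp := integrable_exp_truncNormal hv hab μ ((μ' - μ) / v)
  simp only [← truncNormal_tilted hv hab μ μ']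
  exact integral_tilted_le_of_antitone hf (.of_bound hfm C (ae_of_all _ hC))
    (monotone_id.const_mul hslope) hexp (hexp.bdd_mul hfm (ae_of_all _ hC))

lemma continuous_integral_truncNormal {F : ℝ → ℝ → ℝ} {C : ℝ} (hFm : ∀ μ, Measurable (F μ))
    (hFC : ∀ μ x, ‖F μ x‖ ≤ C) (hFc : ∀ x, Continuous fun μ => F μ x) :
    Continuous fun μ => ∫ x, F μ x ∂(truncNormal μ v a b) := by
  have := isProbabilityMeasure_truncNormal 0 hv hab
  refine (continuous_integral_tilted (integrable_exp_truncNormal hv hab 0)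
    (θ := fun μ => (μ - 0) / v) (by fun_prop) (fun μ => (hFm μ).aestronglyMeasurable)
    hFC hFc).congr fun μ => ?_
  rw [truncNormal_tilted hv hab 0 μ]

end TruncNormal

/-! ### The distribution function as a function of the mean -/

lemma cdf_gaussianReal (μ : ℝ) (v : ℝ≥0) (x : ℝ) :
    cdf (gaussianReal μ v) x = cdf (gaussianReal 0 v) (x - μ) := by
  have hpre : (· + μ) ⁻¹' Set.Iic x = Set.Iic (x - μ) := Set.preimage_add_const_Iic μ x
  rw [cdf_eq_real, cdf_eq_real, ← hpre, ← map_measureReal_apply (by fun_prop) measurableSet_Iic,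
    gaussianReal_map_add_const, zero_add]

lemma tendsto_cdf_gaussianReal_atTop (v : ℝ≥0) (x : ℝ) :
    Tendsto (fun μ => cdf (gaussianReal μ v) x) atTop (𝓝 0) := by
  simp only [cdf_gaussianReal _ v x]
  exact (tendsto_cdf_atBot _).comp (tendsto_atBot_add_const_left _ x tendsto_neg_atTop_atBot)

lemma tendsto_cdf_gaussianReal_atBot (v : ℝ≥0) (x : ℝ) :
    Tendsto (fun μ => cdf (gaussianReal μ v) x) atBot (𝓝 1) := by
  simp only [cdf_gaussianReal _ v x]
  exact (tendsto_cdf_atTop _).comp (tendsto_atTop_add_const_left _ x tendsto_neg_atBot_atTop)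

lemma integral_lt_integral {X : Type*} [MeasurableSpace X] {κ : Measure X} [NeZero κ] {f g : X → ℝ}
    (hf : Integrable f κ) (hg : Integrable g κ) (h : ∀ x, f x < g x) :
    ∫ x, f x ∂κ < ∫ x, g x ∂κ := by
  have hsupp : (Function.support fun x => g x - f x) = Set.univ :=
    Set.eq_univ_of_forall fun x => (sub_pos.2 (h x)).ne'
  rw [← sub_pos, ← integral_sub hg hf,
    integral_pos_iff_support_of_nonneg (fun x => (sub_pos.2 (h x)).le) (hg.sub hf), hsupp]
  exact NeZero.pos (κ Set.univ)

lemma norm_cdf_le_one (ν : Measure ℝ) (x : ℝ) : ‖cdf ν x‖ ≤ 1 := by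
  rw [Real.norm_of_nonneg (cdf_nonneg ν x)]
  exact cdf_le_one ν x

section Mean

variable {v₁ v₂ : ℝ≥0} {c₁ c₂ : ℝ} {a b : EReal}

lemma antitone_cdf_section (ν : Measure ℝ) (hc₁ : 0 ≤ c₁) (hc₂ : 0 ≤ c₂) (z : ℝ) :
    Antitone fun x => cdf ν ((z - c₂ * x) / c₁) := by
  intro x y hxy
  refine monotone_cdf ν ?_
  gcongr

lemma integrable_cdf_section (ν κ : Measure ℝ) [IsFiniteMeasure κ] (hc₁ : 0 ≤ c₁) (hc₂ : 0 ≤ c₂)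
    (z : ℝ) : Integrable (fun x => cdf ν ((z - c₂ * x) / c₁)) κ :=
  .of_bound (antitone_cdf_section ν hc₁ hc₂ z).measurable.aestronglyMeasurable 1
    (ae_of_all _ fun _ => norm_cdf_le_one ν _)

lemma strictAnti_sntnCDF (hv₁ : v₁ ≠ 0) (hv₂ : v₂ ≠ 0) (hc₁ : 0 < c₁) (hc₂ : 0 ≤ c₂)
    (hab : a < b) (z : ℝ) : StrictAnti fun μ => sntnCDF μ v₁ μ v₂ a b c₁ c₂ z := by
  intro μ μ' hμ
  have := isProbabilityMeasure_truncNormal μ' hv₂ hab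
  have := isOpenPosMeasure_gaussianReal 0 hv₁
  have hlt : ∀ x, cdf (gaussianReal μ' v₁) ((z - c₂ * x) / c₁) <
      cdf (gaussianReal μ v₁) ((z - c₂ * x) / c₁) := fun x => by
    rw [cdf_gaussianReal, cdf_gaussianReal μ]
    exact strictMono_cdf _ (sub_lt_sub_left hμ _)
  simp only [sntnCDF_eq_integral _ _ _ _ _ _ _ hc₁]
  calc ∫ x, cdf (gaussianReal μ' v₁) ((z - c₂ * x) / c₁) ∂(truncNormal μ' v₂ a b)
      < ∫ x, cdf (gaussianReal μ v₁) ((z - c₂ * x) / c₁) ∂(truncNormal μ' v₂ a b) :=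
        integral_lt_integral (integrable_cdf_section _ _ hc₁.le hc₂ z)
          (integrable_cdf_section _ _ hc₁.le hc₂ z) hlt
    _ ≤ ∫ x, cdf (gaussianReal μ v₁) ((z - c₂ * x) / c₁) ∂(truncNormal μ v₂ a b) :=
        antitone_integral_truncNormal hv₂ hab (antitone_cdf_section _ hc₁.le hc₂ z)
          (fun _ => norm_cdf_le_one _ _) hμ.le

lemma continuous_sntnCDF_mean (hv₁ : v₁ ≠ 0) (hv₂ : v₂ ≠ 0) (hc₁ : 0 < c₁) (hc₂ : 0 ≤ c₂)
    (hab : a < b) (z : ℝ) : Continuous fun μ => sntnCDF μ v₁ μ v₂ a b c₁ c₂ z := by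
  have := nullSingletonClass_gaussianReal (μ := 0) hv₁
  simp only [sntnCDF_eq_integral _ _ _ _ _ _ _ hc₁]
  refine continuous_integral_truncNormal hv₂ hab
    (fun μ => (antitone_cdf_section _ hc₁.le hc₂ z).measurable) (fun _ _ => norm_cdf_le_one _ _)
    fun x => ?_
  exact ((continuous_cdf (gaussianReal 0 v₁)).comp
    (continuous_sub_left ((z - c₂ * x) / c₁))).congr fun μ => (cdf_gaussianReal μ v₁ _).symm

lemma tendsto_integral_cdf_section (hc₁ : 0 ≤ c₁) (hc₂ : 0 ≤ c₂) (z : ℝ) (κ : Measure ℝ)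
    [IsProbabilityMeasure κ] {ν : ℝ → Measure ℝ} {l : Filter ℝ} [l.IsCountablyGenerated] {k : ℝ}
    (hl : ∀ x, Tendsto (fun μ => cdf (ν μ) x) l (𝓝 k)) :
    Tendsto (fun μ => ∫ x, cdf (ν μ) ((z - c₂ * x) / c₁) ∂κ) l (𝓝 k) := by
  have hlim := tendsto_integral_filter_of_dominated_convergence (μ := κ) (l := l) (fun _ => 1)
    (Eventually.of_forall fun μ => (integrable_cdf_section (ν μ) κ hc₁ hc₂ z).aestronglyMeasurable)
    (Eventually.of_forall fun μ => ae_of_all _ fun _ => norm_cdf_le_one (ν μ) _)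
    (integrable_const 1) (ae_of_all _ fun x => hl ((z - c₂ * x) / c₁))
  simpa using hlim

lemma tendsto_sntnCDF_mean_atTop (hv₂ : v₂ ≠ 0) (hc₁ : 0 < c₁) (hc₂ : 0 ≤ c₂)
    (hab : a < b) (z : ℝ) : Tendsto (fun μ => sntnCDF μ v₁ μ v₂ a b c₁ c₂ z) atTop (𝓝 0) := by
  have := isProbabilityMeasure_truncNormal 0 hv₂ hab
  refine tendsto_of_tendsto_of_tendsto_of_le_of_le' tendsto_const_nhds
    (tendsto_integral_cdf_section hc₁.le hc₂ z (truncNormal 0 v₂ a b)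
      (tendsto_cdf_gaussianReal_atTop v₁)) (Eventually.of_forall fun μ => measureReal_nonneg) ?_
  filter_upwards [eventually_ge_atTop 0] with μ hμ
  rw [sntnCDF_eq_integral _ _ _ _ _ _ _ hc₁]
  exact antitone_integral_truncNormal hv₂ hab (antitone_cdf_section _ hc₁.le hc₂ z)
    (fun _ => norm_cdf_le_one _ _) hμ

lemma tendsto_sntnCDF_mean_atBot (hv₂ : v₂ ≠ 0) (hc₁ : 0 < c₁) (hc₂ : 0 ≤ c₂)
    (hab : a < b) (z : ℝ) : Tendsto (fun μ => sntnCDF μ v₁ μ v₂ a b c₁ c₂ z) atBot (𝓝 1) := by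
  have := isProbabilityMeasure_truncNormal 0 hv₂ hab
  refine tendsto_of_tendsto_of_tendsto_of_le_of_le'
    (tendsto_integral_cdf_section hc₁.le hc₂ z (truncNormal 0 v₂ a b)
      (tendsto_cdf_gaussianReal_atBot v₁)) tendsto_const_nhds ?_ (Eventually.of_forall fun μ => ?_)
  · filter_upwards [eventually_le_atBot 0] with μ hμ
    rw [sntnCDF_eq_integral _ _ _ _ _ _ _ hc₁]
    exact antitone_integral_truncNormal hv₂ hab (antitone_cdf_section _ hc₁.le hc₂ z)
      (fun _ => norm_cdf_le_one _ _) hμ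
  · rw [sntnCDF_eq_cdf μ hv₂ μ v₁ hab]
    exact cdf_le_one _ _

lemma Ioo_subset_range_sntnCDF_mean (hv₁ : v₁ ≠ 0) (hv₂ : v₂ ≠ 0) (hc₁ : 0 < c₁) (hc₂ : 0 ≤ c₂)
    (hab : a < b) (z : ℝ) : Set.Ioo 0 1 ⊆ Set.range fun μ => sntnCDF μ v₁ μ v₂ a b c₁ c₂ z :=
  fun _ ht => mem_range_of_exists_le_of_exists_ge
    (continuous_sntnCDF_mean hv₁ hv₂ hc₁ hc₂ hab z)
    (((tendsto_sntnCDF_mean_atTop hv₂ hc₁ hc₂ hab z).eventually (gt_mem_nhds ht.1)).exists.imp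
      fun _ => le_of_lt)
    (((tendsto_sntnCDF_mean_atBot hv₂ hc₁ hc₂ hab z).eventually (lt_mem_nhds ht.2)).exists.imp
      fun _ => le_of_lt)

end Mean

/-! ### Confidence bounds -/

section Roots

variable {G : ℝ → ℝ} {α : ℝ}

lemma ciLower_eq (hG : StrictAnti G) {μ : ℝ} (h : G μ = 1 - α / 2) : ciLower G α = μ := by
  have hset : {ν : ℝ | 1 - α / 2 ≤ G ν} = Set.Iic μ :=
    Set.ext fun ν => by rw [Set.mem_ofPred_eq, ← h, hG.le_iff_ge, Set.mem_Iic]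
  rw [ciLower, hset, csSup_Iic]

lemma ciUpper_eq (hG : StrictAnti G) {μ : ℝ} (h : G μ = α / 2) : ciUpper G α = μ := by
  have hset : {ν : ℝ | G ν ≤ α / 2} = Set.Ici μ :=
    Set.ext fun ν => by rw [Set.mem_ofPred_eq, ← h, hG.le_iff_ge, Set.mem_Ici]
  rw [ciUpper, hset, csInf_Ici]

variable (hG : StrictAnti G) (hrange : Set.Ioo 0 1 ⊆ Set.range G) (hα : α ∈ Set.Ioo (0 : ℝ) 1)
include hG hrange hα

lemma map_ciLower : G (ciLower G α) = 1 - α / 2 := by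
  obtain ⟨μ, hμ⟩ := hrange (show 1 - α / 2 ∈ Set.Ioo 0 1 from
    ⟨by linarith [hα.2], by linarith [hα.1]⟩)
  rwa [ciLower_eq hG hμ]

lemma map_ciUpper : G (ciUpper G α) = α / 2 := by
  obtain ⟨μ, hμ⟩ := hrange (show α / 2 ∈ Set.Ioo 0 1 from
    ⟨by linarith [hα.1], by linarith [hα.2]⟩)
  rwa [ciUpper_eq hG hμ]

lemma eq_ciLower_iff (μ : ℝ) : G μ = 1 - α / 2 ↔ μ = ciLower G α :=
  ⟨fun h => (ciLower_eq hG h).symm, fun h => h ▸ map_ciLower hG hrange hα⟩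

lemma eq_ciUpper_iff (μ : ℝ) : G μ = α / 2 ↔ μ = ciUpper G α :=
  ⟨fun h => (ciUpper_eq hG h).symm, fun h => h ▸ map_ciUpper hG hrange hα⟩

lemma mem_Icc_ci_iff (μ : ℝ) :
    μ ∈ Set.Icc (ciLower G α) (ciUpper G α) ↔ G μ ∈ Set.Icc (α / 2) (1 - α / 2) := by
  rw [Set.mem_Icc, Set.mem_Icc, ← hG.le_iff_ge (a := μ), ← hG.le_iff_ge (b := μ),
    map_ciLower hG hrange hα, map_ciUpper hG hrange hα, and_comm]

end Roots

lemma exactInference_of_hasLaw {Ω : Type*} [MeasurableSpace Ω] {Q : Measure Ω}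
    {F : EReal → EReal → ℝ → ℝ → ℝ} {T : Ω → ℝ} {lo up : Ω → EReal} {β : ℝ}
    (hF : ∀ a b : EReal, a < b → ∀ z, StrictAnti fun μ => F a b μ z)
    (hF' : ∀ a b : EReal, a < b → ∀ z, Set.Ioo 0 1 ⊆ Set.range fun μ => F a b μ z)
    (hlt : ∀ᵐ ω ∂Q, lo ω < up ω)
    (hlaw : HasLaw (fun ω => F (lo ω) (up ω) β (T ω)) (volume.restrict (Set.Ioo 0 1)) Q) :
    ExactInference Q F T lo up β where
  lower_lt_upper := hlt
  uniform := by
    rw [pdf.IsUniform, hlaw.map_eq, ProbabilityTheory.cond, Real.volume_Ioo, sub_zero,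
      ENNReal.ofReal_one, inv_one, one_smul]
  coverage α hα := by
    have hsub : Set.Icc (α / 2) (1 - α / 2) ⊆ Set.Ioo 0 1 := fun t ht =>
      ⟨by linarith [ht.1, hα.1], by linarith [ht.2, hα.1]⟩
    calc Q {ω | β ∈ Set.Icc (ciLower (fun μ => F (lo ω) (up ω) μ (T ω)) α)
          (ciUpper (fun μ => F (lo ω) (up ω) μ (T ω)) α)}
        = Q {ω | F (lo ω) (up ω) β (T ω) ∈ Set.Icc (α / 2) (1 - α / 2)} := by
          refine measure_congr (hlt.mono fun ω hω => propext ?_)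
          exact mem_Icc_ci_iff (hF _ _ hω (T ω)) (hF' _ _ hω (T ω)) hα β
      _ = (volume.restrict (Set.Ioo 0 1)) (Set.Icc (α / 2) (1 - α / 2)) :=
          hlaw.measure_eq measurableSet_Icc
      _ = ENNReal.ofReal (1 - α) := by
          rw [Measure.restrict_apply measurableSet_Icc, Set.inter_eq_self_of_subset_left hsub,
            Real.volume_Icc]
          congr 1
          ring

/-! ### The SNTN distribution function through the bivariate normal law -/

section Standardize

variable {s : ℝ} (hs : 0 < s) (μ x : ℝ)
include hs

lemma le_coe_mul_add_iff (a : EReal) :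
    a ≤ ((s * x + μ : ℝ) : EReal) ↔ (a - (μ : EReal)) / (s : EReal) ≤ (x : EReal) := by
  rw [EReal.div_le_iff_le_mul (EReal.coe_pos.2 hs) (EReal.coe_ne_top s),
    EReal.sub_le_iff_le_add (.inl (EReal.coe_ne_bot μ)) (.inl (EReal.coe_ne_top μ))]
  push_cast
  rfl

lemma coe_mul_add_le_iff (b : EReal) :
    ((s * x + μ : ℝ) : EReal) ≤ b ↔ (x : EReal) ≤ (b - (μ : EReal)) / (s : EReal) := by
  rw [EReal.le_div_iff_mul_le (EReal.coe_pos.2 hs) (EReal.coe_ne_top s),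
    EReal.le_sub_iff_add_le (.inl (EReal.coe_ne_bot μ)) (.inl (EReal.coe_ne_top μ)), mul_comm]
  push_cast
  rfl

lemma mul_add_mem_eInterval_iff (a b : EReal) :
    s * x + μ ∈ eInterval a b ↔
      x ∈ eInterval ((a - (μ : EReal)) / (s : EReal)) ((b - (μ : EReal)) / (s : EReal)) :=
  (le_coe_mul_add_iff hs μ x a).and (coe_mul_add_le_iff hs μ x b)

end Standardize

lemma map_stdNormal_mul_add (μ : ℝ) (v : ℝ≥0) :
    (gaussianReal 0 1).map (fun x => √(v : ℝ) * x + μ) = gaussianReal μ v := by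
  have hcomp : (fun x : ℝ => √(v : ℝ) * x + μ) = (· + μ) ∘ (√(v : ℝ) * ·) := rfl
  rw [hcomp, ← Measure.map_map (by fun_prop) (by fun_prop), gaussianReal_map_const_mul,
    gaussianReal_map_add_const]
  congr 1
  · ring
  · ext
    simp

lemma measureReal_coe_le_sub {X : Type*} [MeasurableSpace X] (κ : Measure X) [IsFiniteMeasure κ]
    {s : Set X} (hs : MeasurableSet s) {f : X → ℝ} (hf : Measurable f)
    (hf₀ : ∀ t, κ (f ⁻¹' {t}) = 0) {w d : EReal} (hwd : w ≤ d) :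
    κ.real {q | q ∈ s ∧ (f q : EReal) ≤ d} - κ.real {q | q ∈ s ∧ (f q : EReal) ≤ w} =
      κ.real {q | q ∈ s ∧ f q ∈ eInterval w d} := by
  have hmeas : MeasurableSet {q | q ∈ s ∧ (f q : EReal) ≤ w} :=
    hs.inter (measurableSet_le hf.coe_real_ereal measurable_const)
  have hne : ∀ᵐ q ∂κ, (f q : EReal) ≠ w := by
    refine measure_mono_null (fun q hq => ?_) (hf₀ w.toReal)
    rw [← not_not.1 hq]
    rfl
  have hsub : {q | q ∈ s ∧ (f q : EReal) ≤ w} ⊆ {q | q ∈ s ∧ (f q : EReal) ≤ d} :=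
    fun q hq => ⟨hq.1, hq.2.trans hwd⟩
  rw [← measureReal_sdiff hsub hmeas]
  refine measureReal_congr (hne.mono fun q hq => propext ?_)
  constructor
  · rintro ⟨⟨hqs, hqd⟩, hqw⟩
    exact ⟨hqs, (not_le.1 fun h => hqw ⟨hqs, h⟩).le, hqd⟩
  · rintro ⟨hqs, hwq, hqd⟩
    exact ⟨⟨hqs, hqd⟩, fun h => hq (h.2.antisymm hwq)⟩

lemma stdNormalCDF_sub {w d : EReal} (hwd : w ≤ d) :
    stdNormalCDF d - stdNormalCDF w = (gaussianReal 0 1).real (eInterval w d) := by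
  have := nullSingletonClass_gaussianReal (μ := 0) (one_ne_zero (α := ℝ≥0))
  have hsub := measureReal_coe_le_sub (gaussianReal 0 1) .univ measurable_id
    (fun t => measure_singleton t) hwd
  simp only [Set.mem_univ, true_and] at hsub
  exact hsub

lemma bivariateNormalCDF_eq (ρ x : ℝ) (d : EReal) :
    bivariateNormalCDF ρ x d = ((gaussianReal 0 1).prod (gaussianReal 0 1)).real
      {q | ρ * q.2 + √(1 - ρ ^ 2) * q.1 ≤ x ∧ (q.2 : EReal) ≤ d} := by
  rw [bivariateNormalCDF, stdBivariateNormal, map_measureReal_apply (by fun_prop)]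
  · rfl
  · exact (measurableSet_le measurable_fst measurable_const).inter
      (measurableSet_le measurable_snd.coe_real_ereal measurable_const)

lemma bivariateNormalCDF_sub (ρ x : ℝ) {w d : EReal} (hwd : w ≤ d) :
    bivariateNormalCDF ρ x d - bivariateNormalCDF ρ x w =
      ((gaussianReal 0 1).prod (gaussianReal 0 1)).real
        {q | ρ * q.2 + √(1 - ρ ^ 2) * q.1 ≤ x ∧ q.2 ∈ eInterval w d} := by
  have := nullSingletonClass_gaussianReal (μ := 0) (one_ne_zero (α := ℝ≥0))
  have hnull (t : ℝ) :
      ((gaussianReal 0 1).prod (gaussianReal 0 1)) ((Prod.snd : ℝ × ℝ → ℝ) ⁻¹' {t}) = 0 := by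
    rw [← Set.univ_prod, Measure.prod_prod, measure_singleton, mul_zero]
  rw [bivariateNormalCDF_eq, bivariateNormalCDF_eq]
  have hmeas : MeasurableSet {q : ℝ × ℝ | ρ * q.2 + √(1 - ρ ^ 2) * q.1 ≤ x} :=
    measurableSet_le (by fun_prop) measurable_const
  exact measureReal_coe_le_sub _ hmeas measurable_snd hnull hwd

lemma gaussianReal_real_eInterval (μ : ℝ) {v : ℝ≥0} (hv : v ≠ 0) (a b : EReal) :
    (gaussianReal μ v).real (eInterval a b) = (gaussianReal 0 1).real
      (eInterval ((a - (μ : EReal)) / (√(v : ℝ) : EReal))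
        ((b - (μ : EReal)) / (√(v : ℝ) : EReal))) := by
  have hs : 0 < √(v : ℝ) := Real.sqrt_pos.2 (NNReal.coe_pos.2 (pos_iff_ne_zero.2 hv))
  rw [← map_stdNormal_mul_add, map_measureReal_apply (by fun_prop) (measurableSet_eInterval a b)]
  congr 1
  exact Set.ext fun x => mul_add_mem_eInterval_iff hs μ x a b

lemma sqrt_one_sub_div_sq {x y σ : ℝ} (hx : 0 ≤ x) (hσ : 0 < σ) (h : σ ^ 2 = x ^ 2 + y ^ 2) :
    √(1 - (y / σ) ^ 2) = x / σ := by
  have hsq : 1 - (y / σ) ^ 2 = (x / σ) ^ 2 := by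
    field_simp
    linarith
  rw [hsq, Real.sqrt_sq (by positivity)]

section Bivariate

variable {v₁ v₂ : ℝ≥0} (hv₁ : v₁ ≠ 0) (hv₂ : v₂ ≠ 0) {c₁ : ℝ} (hc₁ : 0 < c₁) {c₂ σ ρ : ℝ}
  (hσ : σ = √(c₁ ^ 2 * v₁ + c₂ ^ 2 * v₂)) (hρ : ρ = c₂ * √(v₂ : ℝ) / σ)
include hv₁ hc₁ hσ hρ

lemma standardize_le_iff (μ₁ μ₂ z : ℝ) (q : ℝ × ℝ) :
    c₁ * (√(v₁ : ℝ) * q.1 + μ₁) + c₂ * (√(v₂ : ℝ) * q.2 + μ₂) ≤ z ↔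
      ρ * q.2 + √(1 - ρ ^ 2) * q.1 ≤ (z - (c₁ * μ₁ + c₂ * μ₂)) / σ := by
  have hσ₀ : 0 < σ := by
    have : 0 < v₁ := pos_iff_ne_zero.2 hv₁
    rw [hσ]
    positivity
  have hσ₂ : σ ^ 2 = (c₁ * √(v₁ : ℝ)) ^ 2 + (c₂ * √(v₂ : ℝ)) ^ 2 := by
    rw [hσ, Real.sq_sqrt (by positivity), mul_pow, mul_pow, Real.sq_sqrt v₁.coe_nonneg,
      Real.sq_sqrt v₂.coe_nonneg]
  have hsum : (ρ * q.2 + √(1 - ρ ^ 2) * q.1) * σ =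
      c₂ * √(v₂ : ℝ) * q.2 + c₁ * √(v₁ : ℝ) * q.1 := by
    rw [hρ, sqrt_one_sub_div_sq (by positivity) hσ₀ hσ₂]
    field_simp
  rw [le_div_iff₀ hσ₀, hsum]
  constructor <;> intro h <;> linarith

include hv₂

lemma sntnCDF_eq_bivariateNormalCDF {a b : EReal} (hab : a ≤ b) (μ₁ μ₂ z : ℝ) {w d : EReal}
    (hw : w = (a - (μ₂ : EReal)) / (√(v₂ : ℝ) : EReal))
    (hd : d = (b - (μ₂ : EReal)) / (√(v₂ : ℝ) : EReal)) :
    sntnCDF μ₁ v₁ μ₂ v₂ a b c₁ c₂ z =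
      (bivariateNormalCDF ρ ((z - (c₁ * μ₁ + c₂ * μ₂)) / σ) d
        - bivariateNormalCDF ρ ((z - (c₁ * μ₁ + c₂ * μ₂)) / σ) w)
      / (stdNormalCDF d - stdNormalCDF w) := by
  have hs₂ : 0 < √(v₂ : ℝ) := Real.sqrt_pos.2 (NNReal.coe_pos.2 (pos_iff_ne_zero.2 hv₂))
  have hwd : w ≤ d := by
    rw [hw, hd]
    exact EReal.div_le_div_right_of_nonneg (EReal.coe_nonneg.2 hs₂.le)
      (EReal.sub_le_sub hab le_rfl)
  have hmeas : MeasurableSet {q : ℝ × ℝ | c₁ * q.1 + c₂ * q.2 ≤ z ∧ q.2 ∈ eInterval a b} := by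
    have hle : MeasurableSet {q : ℝ × ℝ | c₁ * q.1 + c₂ * q.2 ≤ z} :=
      measurableSet_le (by fun_prop) measurable_const
    exact hle.inter (measurable_snd (measurableSet_eInterval a b))
  rw [sntnCDF_eq_div, stdNormalCDF_sub hwd, bivariateNormalCDF_sub _ _ hwd,
    gaussianReal_real_eInterval μ₂ hv₂, ← hw, ← hd, ← map_stdNormal_mul_add μ₁ v₁,
    ← map_stdNormal_mul_add μ₂ v₂, Measure.map_prod_map _ _ (by fun_prop) (by fun_prop),
    map_measureReal_apply (by fun_prop) hmeas]
  congr 2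
  ext q
  rw [hw, hd]
  exact (standardize_le_iff hv₁ hc₁ hσ hρ μ₁ μ₂ z q).and
    (mul_add_mem_eInterval_iff hs₂ μ₂ q.2 a b)

end Bivariate

/-! ### Random truncation points -/

section RandomTruncation

variable {𝓨 : Type*} [MeasurableSpace 𝓨] {lo up : 𝓨 → EReal} {D : Set 𝓨}

lemma measurableSet_mem_and_mem_eInterval (hlo : Measurable lo) (hup : Measurable up)
    (hD : MeasurableSet D) :
    MeasurableSet {q : 𝓨 × ℝ × ℝ | q.1 ∈ D ∧ q.2.2 ∈ eInterval (lo q.1) (up q.1)} :=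
  (measurable_fst hD).inter
    (measurableSet_mem_eInterval (f := fun q : 𝓨 × ℝ × ℝ => q.2.2) (hlo.comp measurable_fst)
      (hup.comp measurable_fst) (by fun_prop))

lemma hasLawOn_sntnCDF_prod (κ : Measure 𝓨) [SFinite κ] (μ₁ μ₂ : ℝ) {v₁ v₂ : ℝ≥0}
    (hv₁ : v₁ ≠ 0) (hv₂ : v₂ ≠ 0) {c₁ : ℝ} (hc₁ : c₁ ≠ 0) (c₂ : ℝ)
    (hlo : Measurable lo) (hup : Measurable up) (hD : MeasurableSet D) :
    HasLawOn (fun q : 𝓨 × ℝ × ℝ =>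
        sntnCDF μ₁ v₁ μ₂ v₂ (lo q.1) (up q.1) c₁ c₂ (c₁ * q.2.1 + c₂ * q.2.2))
      (volume.restrict (Set.Ioo 0 1))
      (κ.prod ((gaussianReal μ₁ v₁).prod (gaussianReal μ₂ v₂)))
      {q | q.1 ∈ D ∧ q.2.2 ∈ eInterval (lo q.1) (up q.1)} := by
  refine .prod (measurableSet_mem_and_mem_eInterval hlo hup hD)
    (measurable_sntnCDF_comp _ _ _ _ _ _ (by fun_prop) (by fun_prop) (by fun_prop)) fun y => ?_
  by_cases hy : y ∈ D
  · convert hasLawOn_sntnCDF μ₁ μ₂ (lo y) (up y) c₂ hv₁ hv₂ hc₁ using 1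
    ext q
    simp [hy]
  · exact .of_measure_eq_zero (measure_mono_null (fun q hq => hy hq.1) measure_empty)

lemma ae_lt_of_mem_eInterval (κ : Measure 𝓨) (μ : ℝ) {v : ℝ≥0} (hv : v ≠ 0)
    (hlo : Measurable lo) (hup : Measurable up) :
    ∀ᵐ q ∂κ.prod (gaussianReal μ v), q.2 ∈ eInterval (lo q.1) (up q.1) → lo q.1 < up q.1 := by
  have hmem : MeasurableSet {q : 𝓨 × ℝ | q.2 ∈ eInterval (lo q.1) (up q.1)} :=
    measurableSet_mem_eInterval (by fun_prop) (by fun_prop) measurable_snd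
  have hlt : MeasurableSet {q : 𝓨 × ℝ | lo q.1 < up q.1} :=
    measurableSet_lt (by fun_prop) (by fun_prop)
  refine (Measure.ae_prod_iff_ae_ae (hmem.imp hlt)).2 (ae_of_all _ fun y => ?_)
  rcases lt_or_ge (lo y) (up y) with hy | hy
  · exact ae_of_all _ fun _ _ => hy
  · filter_upwards [measure_eq_zero_iff_ae_notMem.1 (gaussianReal_eInterval_eq_zero μ hv hy)]
      with x hx hxmem using absurd hxmem hx

end RandomTruncation

/-! ### Polyhedra as truncation events -/

section Geometry

variable {S : Type*} [Fintype S] {η : S → ℝ} {m : ℕ}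

lemma dotProduct_direction (hη : η ⬝ᵥ η ≠ 0) : η ⬝ᵥ direction η = 1 := by
  rw [direction, dotProduct_smul, smul_eq_mul, inv_mul_cancel₀ hη]

lemma dotProduct_residual (hη : η ⬝ᵥ η ≠ 0) (u : S → ℝ) : η ⬝ᵥ residual η u = 0 := by
  rw [residual, dotProduct_sub, dotProduct_smul, dotProduct_direction hη, smul_eq_mul, mul_one,
    sub_self]

lemma residual_residual (hη : η ⬝ᵥ η ≠ 0) (u : S → ℝ) :
    residual η (residual η u) = residual η u := by
  rw [residual, dotProduct_residual hη, zero_smul, sub_zero]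

lemma measurable_residual (η : S → ℝ) : Measurable (residual η) :=
  (continuous_id.sub
    ((continuous_const.dotProduct continuous_id).smul continuous_const)).measurable

variable (η) (A : Matrix (Fin m) S ℝ) (b : Fin m → ℝ) (u : S → ℝ)

lemma mulVec_eq_residual_add (i : Fin m) :
    (A *ᵥ u) i = (A *ᵥ residual η u) i + (η ⬝ᵥ u) * (A *ᵥ direction η) i := by
  conv_lhs => rw [← sub_add_cancel u ((η ⬝ᵥ u) • direction η), Matrix.mulVec_add,
    Matrix.mulVec_smul]
  rfl

lemma truncLower_le_iff (t : ℝ) :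
    truncLower η A b u ≤ t ↔ ∀ i, (A *ᵥ direction η) i < 0 →
      (A *ᵥ residual η u) i + t * (A *ᵥ direction η) i ≤ b i := by
  simp only [truncLower, iSup_le_iff, EReal.coe_le_coe_iff]
  exact forall₂_congr fun i hi => by rw [div_le_iff_of_neg hi, le_sub_iff_add_le']

lemma le_truncUpper_iff (t : ℝ) :
    t ≤ truncUpper η A b u ↔ ∀ i, 0 < (A *ᵥ direction η) i →
      (A *ᵥ residual η u) i + t * (A *ᵥ direction η) i ≤ b i := by
  simp only [truncUpper, le_iInf_iff, EReal.coe_le_coe_iff]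
  exact forall₂_congr fun i hi => by rw [le_div_iff₀ hi, le_sub_iff_add_le']

/-- The points that satisfy those constraints of the polyhedron on which a move along `η` has no
effect; they are the constraints that do not enter the truncation points. -/
def freeConstraints : Set (S → ℝ) :=
  {r | ∀ i, (A *ᵥ direction η) i = 0 → (A *ᵥ r) i ≤ b i}

lemma mem_polyhedron_iff :
    u ∈ polyhedron A b ↔ residual η u ∈ freeConstraints η A b ∧
      η ⬝ᵥ u ∈ eInterval (truncLower η A b u) (truncUpper η A b u) := by
  change (∀ i, (A *ᵥ u) i ≤ b i) ↔
    (∀ i, (A *ᵥ direction η) i = 0 → (A *ᵥ residual η u) i ≤ b i) ∧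
      truncLower η A b u ≤ ((η ⬝ᵥ u : ℝ) : EReal) ∧ ((η ⬝ᵥ u : ℝ) : EReal) ≤ truncUpper η A b u
  simp only [truncLower_le_iff, le_truncUpper_iff, mulVec_eq_residual_add η A u]
  refine ⟨fun h => ⟨fun i hi => ?_, fun i _ => h i, fun i _ => h i⟩,
    fun ⟨hzero, hneg, hpos⟩ i => ?_⟩
  · simpa only [hi, mul_zero, add_zero] using h i
  · rcases lt_trichotomy ((A *ᵥ direction η) i) 0 with hi | hi | hi
    · exact hneg i hi
    · simpa only [hi, mul_zero, add_zero] using hzero i hi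
    · exact hpos i hi

lemma measurable_mulVec_apply (i : Fin m) : Measurable fun u : S → ℝ => (A *ᵥ u) i :=
  ((continuous_apply i).comp (continuous_const.matrix_mulVec continuous_id)).measurable

lemma measurableSet_freeConstraints : MeasurableSet (freeConstraints η A b) := by
  simp only [freeConstraints, Set.ofPred_forall]
  exact .iInter fun i => .iInter fun _ =>
    measurableSet_le (measurable_mulVec_apply A i) measurable_const

lemma measurableSet_polyhedron : MeasurableSet (polyhedron A b) := by
  simp only [polyhedron, Set.ofPred_forall]
  exact .iInter fun i => measurableSet_le (measurable_mulVec_apply A i) measurable_const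

lemma measurable_truncPoint (i : Fin m) :
    Measurable fun u : S → ℝ =>
      (((b i - (A *ᵥ residual η u) i) / (A *ᵥ direction η) i : ℝ) : EReal) :=
  ((measurable_const.sub ((measurable_mulVec_apply A i).comp
    (measurable_residual η))).div_const _).coe_real_ereal

lemma measurable_truncLower : Measurable (truncLower η A b) :=
  .iSup fun i => .iSup_Prop _ (measurable_truncPoint η A b i)

lemma measurable_truncUpper : Measurable (truncUpper η A b) :=
  .iInf fun i => .iInf_Prop _ (measurable_truncPoint η A b i)

variable {η}

lemma truncLower_residual (hη : η ⬝ᵥ η ≠ 0) :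
    truncLower η A b (residual η u) = truncLower η A b u := by
  simp only [truncLower, residual_residual hη]

lemma truncUpper_residual (hη : η ⬝ᵥ η ≠ 0) :
    truncUpper η A b (residual η u) = truncUpper η A b u := by
  simp only [truncUpper, residual_residual hη]

end Geometry

/-! ### Gaussian vectors with independent coordinates -/

section GaussianVector

variable {S : Type*} [Fintype S]

lemma pi_gaussianReal_absolutelyContinuous (g : S → ℝ) {v : S → ℝ≥0} (hv : ∀ i, v i ≠ 0) :
    Measure.pi (fun i => gaussianReal (g i) (v i)) ≪ (volume : Measure (S → ℝ)) := by
  have heq : Measure.pi (fun i => gaussianReal (g i) (v i)) =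
      (volume : Measure (S → ℝ)).withDensity
        (fun x => ENNReal.ofReal (∏ i, gaussianPDFReal (g i) (v i) (x i))) := by
    refine Measure.pi_eq fun s hs => ?_
    rw [withDensity_apply _ (MeasurableSet.univ_pi hs), volume_pi, Measure.restrict_pi_pi,
      ← ofReal_integral_eq_lintegral_ofReal, integral_fintype_prod_eq_prod,
      ENNReal.ofReal_prod_of_nonneg fun i _ =>
        integral_nonneg fun x => gaussianPDFReal_nonneg _ _ _]
    · exact Finset.prod_congr rfl fun i _ => (gaussianReal_apply_eq_integral _ (hv i) _).symm
    · exact Integrable.fintype_prod_dep fun i => (integrable_gaussianPDFReal _ _).restrict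
    · exact ae_of_all _ fun x => Finset.prod_nonneg fun i _ => gaussianPDFReal_nonneg _ _ _
  rw [heq]
  exact withDensity_absolutelyContinuous _ _

/-- The continuous linear form `u ↦ ηᵀ u`. -/
noncomputable def dotProductCLM (η : S → ℝ) : (S → ℝ) →L[ℝ] ℝ :=
  LinearMap.toContinuousLinearMap (dotProductBilin ℝ ℝ η)

lemma residual_apply_eq_dotProduct [DecidableEq S] (η w : S → ℝ) (k : S) :
    residual η w k = (Pi.single k 1 - direction η k • η) ⬝ᵥ w := by
  rw [sub_dotProduct, smul_dotProduct, single_one_dotProduct, residual, Pi.sub_apply,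
    Pi.smul_apply, smul_eq_mul, smul_eq_mul, mul_comm]

variable {Ω : Type*} [MeasurableSpace Ω] {P : Measure Ω} {u : Ω → S → ℝ} {g : S → ℝ}

section Coordinates

variable {v : S → ℝ≥0} (hu : HasLaw u (Measure.pi fun i => gaussianReal (g i) (v i)) P)
include hu

lemma hasLaw_eval_of_pi (i : S) : HasLaw (fun ω => u ω i) (gaussianReal (g i) (v i)) P :=
  (measurePreserving_eval (fun i => gaussianReal (g i) (v i)) i).fun_comp_hasLaw hu

lemma memLp_eval_of_pi (i : S) : MemLp (fun ω => u ω i) 2 P :=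
  (hasLaw_eval_of_pi hu i).hasGaussianLaw.memLp_two

lemma integral_dotProduct (η : S → ℝ) : ∫ ω, η ⬝ᵥ u ω ∂P = η ⬝ᵥ g := by
  simp only [dotProduct]
  rw [integral_finsetSum _ fun i _ =>
    ((hasLaw_eval_of_pi hu i).hasGaussianLaw.integrable).const_mul (η i)]
  refine Finset.sum_congr rfl fun i _ => ?_
  rw [integral_const_mul, (hasLaw_eval_of_pi hu i).integral_eq, integral_id_gaussianReal]

variable [IsProbabilityMeasure P]

lemma iIndepFun_eval_of_pi : iIndepFun (fun i ω => u ω i) P :=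
  (iIndepFun_iff_hasLaw_pi_pi (hasLaw_eval_of_pi hu)).2 hu

lemma hasGaussianLaw_of_pi : HasGaussianLaw u P :=
  (iIndepFun_eval_of_pi hu).hasGaussianLaw fun i => (hasLaw_eval_of_pi hu i).hasGaussianLaw

end Coordinates

variable [IsProbabilityMeasure P] {v : ℝ≥0}
  (hu : HasLaw u (Measure.pi fun i => gaussianReal (g i) v) P)
include hu

lemma covariance_dotProduct (η ζ : S → ℝ) :
    cov[fun ω => η ⬝ᵥ u ω, fun ω => ζ ⬝ᵥ u ω; P] = v * (η ⬝ᵥ ζ) := by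
  classical
  have hL := memLp_eval_of_pi hu
  have hcov : ∀ i j, cov[fun ω => u ω i, fun ω => u ω j; P] = if i = j then (v : ℝ) else 0 := by
    intro i j
    split_ifs with h
    · subst h
      rw [covariance_self (hasLaw_eval_of_pi hu i).aemeasurable,
        (hasLaw_eval_of_pi hu i).variance_eq, variance_id_gaussianReal]
    · exact ((iIndepFun_eval_of_pi hu).indepFun h).covariance_eq_zero (hL i) (hL j)
  simp only [dotProduct]
  rw [covariance_fun_sum_fun_sum (fun i => (hL i).const_mul _) (fun i => (hL i).const_mul _)]
  simp only [covariance_const_mul_left, covariance_const_mul_right, hcov, mul_ite, mul_zero,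
    Finset.sum_ite_eq, Finset.mem_univ, if_true, Finset.mul_sum]
  exact Finset.sum_congr rfl fun i _ => by ring

lemma hasLaw_dotProduct (η : S → ℝ) :
    HasLaw (fun ω => η ⬝ᵥ u ω) (gaussianReal (η ⬝ᵥ g) (v * (η ⬝ᵥ η)).toNNReal) P := by
  have hG : HasGaussianLaw (fun ω => η ⬝ᵥ u ω) P := (hasGaussianLaw_of_pi hu).map (dotProductCLM η)
  refine ⟨hG.aemeasurable, ?_⟩
  rw [hG.map_eq_gaussianReal, integral_dotProduct hu, ← covariance_self hG.aemeasurable,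
    covariance_dotProduct hu]

variable {η : S → ℝ} (hη : η ⬝ᵥ η ≠ 0)
include hη

lemma indepFun_residual_dotProduct :
    IndepFun (fun ω => residual η (u ω)) (fun ω => η ⬝ᵥ u ω) P := by
  classical
  let L : (S → ℝ) →L[ℝ] (S → ℝ) × (Unit → ℝ) :=
    (ContinuousLinearMap.pi fun k => dotProductCLM (Pi.single k 1 - direction η k • η)).prod
      (ContinuousLinearMap.pi fun _ => dotProductCLM η)
  have hL : ∀ w, L w = (fun k => residual η w k, fun _ => η ⬝ᵥ w) := fun w =>
    Prod.ext (funext fun k => (residual_apply_eq_dotProduct η w k).symm) rfl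
  have hG : HasGaussianLaw
      (fun ω => (fun k => residual η (u ω) k, fun _ : Unit => η ⬝ᵥ u ω)) P := by
    simpa only [← hL] using (hasGaussianLaw_of_pi hu).map_fun L
  have hcov : ∀ k, cov[fun ω => residual η (u ω) k, fun ω => η ⬝ᵥ u ω; P] = 0 := fun k => by
    simp only [residual_apply_eq_dotProduct]
    rw [covariance_dotProduct hu, sub_dotProduct, smul_dotProduct, single_one_dotProduct,
      direction, Pi.smul_apply, smul_eq_mul, smul_eq_mul, mul_right_comm, inv_mul_cancel₀ hη,
      one_mul, sub_self, mul_zero]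
  exact (hG.indepFun_of_covariance_eval fun k _ => hcov k).comp measurable_id
    (measurable_pi_apply ())

lemma hasLaw_residual_dotProduct :
    HasLaw (fun ω => (residual η (u ω), η ⬝ᵥ u ω))
      ((P.map fun ω => residual η (u ω)).prod
        (gaussianReal (η ⬝ᵥ g) (v * (η ⬝ᵥ η)).toNNReal)) P :=
  (indepFun_residual_dotProduct hu hη).hasLaw_prod
    ⟨(measurable_residual η).comp_aemeasurable hu.aemeasurable, rfl⟩ (hasLaw_dotProduct hu η)

lemma hasLaw_residual_prod {ν : Measure ℝ} [SFinite ν] {W : Ω → ℝ} (hW : HasLaw W ν P)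
    (huW : IndepFun u W P) :
    HasLaw (fun ω => (residual η (u ω), W ω, η ⬝ᵥ u ω))
      ((P.map fun ω => residual η (u ω)).prod
        (ν.prod (gaussianReal (η ⬝ᵥ g) (v * (η ⬝ᵥ η)).toNNReal))) P := by
  have hind : IndepFun (fun ω => (residual η (u ω), η ⬝ᵥ u ω)) W P :=
    huW.comp ((measurable_residual η).prodMk (dotProductCLM η).measurable) measurable_id
  exact (((MeasurePreserving.id _).prod Measure.measurePreserving_swap).comp
    (measurePreserving_prodAssoc _ _ _)).fun_comp_hasLaw
      (hind.hasLaw_prod (hasLaw_residual_dotProduct hu hη) hW)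

end GaussianVector

/-! ### The polyhedral lemma -/

section Polyhedral

variable {S : Type*} [Fintype S] {η : S → ℝ} {v : ℝ≥0} {m : ℕ}

lemma toNNReal_mul_dotProduct_self_ne_zero (hv : v ≠ 0) (hη : η ⬝ᵥ η ≠ 0) :
    (v * (η ⬝ᵥ η)).toNNReal ≠ 0 :=
  (Real.toNNReal_pos.2 (mul_pos (NNReal.coe_pos.2 (pos_iff_ne_zero.2 hv))
    ((Finset.sum_nonneg fun i _ => mul_self_nonneg (η i)).lt_of_ne' hη))).ne'

lemma preimage_polyhedron (hη : η ⬝ᵥ η ≠ 0) {Ω : Type*} (u : Ω → S → ℝ)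
    (W : Ω → ℝ) (A : Matrix (Fin m) S ℝ) (b : Fin m → ℝ) :
    u ⁻¹' polyhedron A b = (fun ω => (residual η (u ω), W ω, η ⬝ᵥ u ω)) ⁻¹'
      {q | q.1 ∈ freeConstraints η A b ∧
        q.2.2 ∈ eInterval (truncLower η A b q.1) (truncUpper η A b q.1)} := by
  ext ω
  simp only [Set.mem_preimage, Set.mem_ofPred_eq, truncLower_residual A b _ hη,
    truncUpper_residual A b _ hη]
  exact mem_polyhedron_iff η A b (u ω)

variable {Ω : Type*} [MeasurableSpace Ω] {P : Measure Ω} [IsProbabilityMeasure P] {u : Ω → S → ℝ}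
  {g : S → ℝ} (hu : HasLaw u (Measure.pi fun i => gaussianReal (g i) v) P) (hv : v ≠ 0)
  (hη : η ⬝ᵥ η ≠ 0) (A : Matrix (Fin m) S ℝ) (b : Fin m → ℝ)
include hu hv hη

lemma ae_truncLower_lt_truncUpper_of_mem_polyhedron :
    ∀ᵐ ω ∂P, u ω ∈ polyhedron A b → truncLower η A b (u ω) < truncUpper η A b (u ω) := by
  have hlaw := hasLaw_residual_dotProduct hu hη
  have h := ae_lt_of_mem_eInterval (P.map fun ω => residual η (u ω)) (η ⬝ᵥ g)
    (toNNReal_mul_dotProduct_self_ne_zero hv hη) (measurable_truncLower η A b)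
    (measurable_truncUpper η A b)
  rw [← hlaw.map_eq] at h
  filter_upwards [ae_of_ae_map hlaw.aemeasurable h] with ω hω hmem
  simp only [truncLower_residual A b _ hη, truncUpper_residual A b _ hη] at hω
  exact hω ((mem_polyhedron_iff η A b (u ω)).1 hmem).2

lemma hasLawOn_preimage_polyhedron {W : Ω → ℝ} (huW : IndepFun u W P) {μ₁ : ℝ} {v₁ : ℝ≥0}
    (hv₁ : v₁ ≠ 0) (hW : HasLaw W (gaussianReal μ₁ v₁) P) {c₁ : ℝ} (hc₁ : c₁ ≠ 0) (c₂ : ℝ) :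
    HasLawOn (fun ω => sntnCDF μ₁ v₁ (η ⬝ᵥ g) (v * (η ⬝ᵥ η)).toNNReal
        (truncLower η A b (u ω)) (truncUpper η A b (u ω)) c₁ c₂ (c₁ * W ω + c₂ * (η ⬝ᵥ u ω)))
      (volume.restrict (Set.Ioo 0 1)) P (u ⁻¹' polyhedron A b) := by
  have hlo := measurable_truncLower η A b
  have hup := measurable_truncUpper η A b
  have hD := measurableSet_freeConstraints η A b
  have h := (hasLawOn_sntnCDF_prod (P.map fun ω => residual η (u ω)) μ₁ (η ⬝ᵥ g) hv₁
    (toNNReal_mul_dotProduct_self_ne_zero hv hη) hc₁ c₂ hlo hup hD).preimage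
    (hasLaw_residual_prod hu hη hW huW) (measurableSet_mem_and_mem_eInterval hlo hup hD)
  simpa only [truncLower_residual A b _ hη, truncUpper_residual A b _ hη,
    ← preimage_polyhedron hη] using h

end Polyhedral

/-! ### Least squares contrasts -/

section Contrast

variable {n p : ℕ} {X : Matrix (Fin n) (Fin p) ℝ} {S : Finset (Fin n)} {M : Finset (Fin p)}

lemma contrast_dotProduct_subDesign (h : IsUnit (gram X S M).det) (j k : M) :
    (contrast X S M j ⬝ᵥ fun i => subDesign X S M i k) = (1 : Matrix M M ℝ) j k := by
  rw [← Matrix.nonsing_inv_mul _ h, gram, ← Matrix.mul_assoc]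
  rfl

lemma contrast_dotProduct_contrast (h : IsUnit (gram X S M).det) (j : M) :
    contrast X S M j ⬝ᵥ contrast X S M j = (gram X S M)⁻¹ j j := by
  have hsymm : ((gram X S M)⁻¹)ᵀ = (gram X S M)⁻¹ := by
    rw [Matrix.transpose_nonsing_inv, gram, Matrix.transpose_mul, Matrix.transpose_transpose]
  have hentry : contrast X S M j ⬝ᵥ contrast X S M j =
      (((gram X S M)⁻¹ * (subDesign X S M)ᵀ) * ((gram X S M)⁻¹ * (subDesign X S M)ᵀ)ᵀ) j j := rfl
  rw [hentry, Matrix.transpose_mul, Matrix.transpose_transpose, hsymm, Matrix.mul_assoc,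
    ← Matrix.mul_assoc (subDesign X S M)ᵀ, ← gram, Matrix.mul_nonsing_inv _ h, Matrix.mul_one]

lemma contrast_dotProduct_contrast_pos (h : IsUnit (gram X S M).det) (j : M) :
    0 < contrast X S M j ⬝ᵥ contrast X S M j := by
  refine (Finset.sum_nonneg fun i _ => mul_self_nonneg _).lt_of_ne' fun hzero => ?_
  have hone := contrast_dotProduct_subDesign h j j
  rw [dotProduct_self_eq_zero.1 hzero, zero_dotProduct, Matrix.one_apply_eq] at hone
  exact zero_ne_one hone

lemma coefVar_eq_sq_mul_dotProduct (h : IsUnit (gram X S M).det) (j : M) (τ : ℝ) :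
    coefVar X τ S M j = τ ^ 2 * (contrast X S M j ⬝ᵥ contrast X S M j) := by
  rw [coefVar, contrast_dotProduct_contrast h]

lemma coefVar_pos (h : IsUnit (gram X S M).det) (j : M) {τ : ℝ} (hτ : τ ≠ 0) :
    0 < coefVar X τ S M j := by
  rw [coefVar_eq_sq_mul_dotProduct h]
  exact mul_pos (sq_pos_of_ne_zero hτ) (contrast_dotProduct_contrast_pos h j)

lemma toNNReal_coefVar_ne_zero (h : IsUnit (gram X S M).det) (j : M) {τ : ℝ} (hτ : τ ≠ 0) :
    (coefVar X τ S M j).toNNReal ≠ 0 :=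
  (Real.toNNReal_pos.2 (coefVar_pos h j hτ)).ne'

end Contrast

/-! ### The distribution function of data carving -/

lemma card_div_pos {n : ℕ} {S : Finset (Fin n)} (hS : S.Nonempty) : 0 < (S.card : ℝ) / n := by
  obtain ⟨i, -⟩ := id hS
  exact div_pos (Nat.cast_pos.2 hS.card_pos) (Nat.cast_pos.2 i.pos)

lemma card_div_add_card_div {n : ℕ} {S T : Finset (Fin n)} (hS : S.Nonempty)
    (hdisj : Disjoint S T) (hcover : S ∪ T = Finset.univ) :
    (S.card : ℝ) / n + (T.card : ℝ) / n = 1 := by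
  obtain ⟨i, -⟩ := hS
  have hn : (n : ℝ) ≠ 0 := Nat.cast_ne_zero.2 i.pos.ne'
  have hcard : S.card + T.card = n := by
    rw [← Finset.card_union_of_disjoint hdisj, hcover, Finset.card_univ, Fintype.card_fin]
  rw [← add_div, div_eq_one_iff_eq hn]
  exact_mod_cast hcard

section CarveCDF

variable {n p : ℕ} {X : Matrix (Fin n) (Fin p) ℝ} {τ : ℝ} (hτ : τ ≠ 0) {SA SB : Finset (Fin n)}
  (hB : SB.Nonempty) {M : Finset (Fin p)} (j : M) (hgramA : IsUnit (gram X SA M).det)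
  (hgramB : IsUnit (gram X SB M).det)
include hτ hB hgramA hgramB

lemma carveCDF_eq_bivariateNormalCDF (hdisj : Disjoint SA SB) (hcover : SA ∪ SB = Finset.univ)
    {a b : EReal} (hab : a ≤ b) (μ z : ℝ) {σ₁ σ₂ ρ : ℝ} {w d : EReal}
    (hσ₁ : σ₁ = √(((SB.card : ℝ) ^ 2 * coefVar X τ SB M j
      + (SA.card : ℝ) ^ 2 * coefVar X τ SA M j) / (n : ℝ) ^ 2))
    (hσ₂ : σ₂ = √(coefVar X τ SA M j)) (hρ : ρ = (SA.card : ℝ) / n * σ₂ / σ₁)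
    (hw : w = (a - (μ : EReal)) / (σ₂ : EReal)) (hd : d = (b - (μ : EReal)) / (σ₂ : EReal)) :
    carveCDF X τ SA SB M j a b μ z =
      (bivariateNormalCDF ρ ((z - μ) / σ₁) d - bivariateNormalCDF ρ ((z - μ) / σ₁) w)
        / (stdNormalCDF d - stdNormalCDF w) := by
  have hA := Real.coe_toNNReal _ (coefVar_pos hgramA j hτ).le
  have hσ : σ₁ = √(((SB.card : ℝ) / n) ^ 2 * (coefVar X τ SB M j).toNNReal +
      ((SA.card : ℝ) / n) ^ 2 * (coefVar X τ SA M j).toNNReal) := by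
    rw [hσ₁, hA, Real.coe_toNNReal _ (coefVar_pos hgramB j hτ).le]
    congr 1
    ring
  have hmean : (SB.card : ℝ) / n * μ + (SA.card : ℝ) / n * μ = μ := by
    rw [← add_mul, card_div_add_card_div hB hdisj.symm (Finset.union_comm SB SA ▸ hcover), one_mul]
  rw [← hA] at hσ₂
  subst hσ₂
  have h := sntnCDF_eq_bivariateNormalCDF (toNNReal_coefVar_ne_zero hgramB j hτ)
    (toNNReal_coefVar_ne_zero hgramA j hτ) (card_div_pos hB) hσ hρ hab μ μ z hw hd
  rwa [hmean] at h

lemma strictAnti_carveCDF {a b : EReal} (hab : a < b) (z : ℝ) :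
    StrictAnti fun μ => carveCDF X τ SA SB M j a b μ z :=
  strictAnti_sntnCDF (toNNReal_coefVar_ne_zero hgramB j hτ) (toNNReal_coefVar_ne_zero hgramA j hτ)
    (card_div_pos hB) (by positivity) hab z

lemma Ioo_subset_range_carveCDF {a b : EReal} (hab : a < b) (z : ℝ) :
    Set.Ioo 0 1 ⊆ Set.range fun μ => carveCDF X τ SA SB M j a b μ z :=
  Ioo_subset_range_sntnCDF_mean (toNNReal_coefVar_ne_zero hgramB j hτ)
    (toNNReal_coefVar_ne_zero hgramA j hτ) (card_div_pos hB) (by positivity) hab z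

lemma exactInference_carveCDF {Ω : Type*} [MeasurableSpace Ω] {P : Measure Ω} [IsFiniteMeasure P]
    {s : Set Ω} (hs : P s ≠ 0) {T : Ω → ℝ} {lo up : Ω → EReal} {β : ℝ}
    (hlt : ∀ᵐ ω ∂(P.restrict s), lo ω < up ω)
    (hlaw : HasLawOn (fun ω => carveCDF X τ SA SB M j (lo ω) (up ω) β (T ω))
      (volume.restrict (Set.Ioo 0 1)) P s) :
    ExactInference (cond P s) (carveCDF X τ SA SB M j) T lo up β :=
  exactInference_of_hasLaw (fun _ _ hab z => strictAnti_carveCDF hτ hB j hgramA hgramB hab z)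
    (fun _ _ hab z => Ioo_subset_range_carveCDF hτ hB j hgramA hgramB hab z)
    (Measure.ae_smul_measure hlt _) (hlaw.hasLaw_cond hs)

end CarveCDF

/-! ### The two parts of the response -/

section Parts

variable {Ω : Type*} [MeasurableSpace Ω] {P : Measure Ω} [IsProbabilityMeasure P]
  {n : ℕ} {g : Fin n → ℝ} {v : ℝ≥0} {y : Ω → Fin n → ℝ}
  (hy : HasLaw y (Measure.pi fun i => gaussianReal (g i) v) P)
include hy

lemma hasLaw_restrict (S : Finset (Fin n)) :
    HasLaw (fun ω => S.restrict (y ω)) (Measure.pi fun i : S => gaussianReal (g i) v) P :=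
  ((iIndepFun_eval_of_pi hy).precomp Subtype.val_injective).hasLaw_pi
    fun i : S => hasLaw_eval_of_pi hy i

lemma indepFun_restrict {S T : Finset (Fin n)} (hdisj : Disjoint S T) :
    IndepFun (fun ω => S.restrict (y ω)) (fun ω => T.restrict (y ω)) P :=
  (iIndepFun_eval_of_pi hy).indepFun_finset₀ S T hdisj
    fun i => (hasLaw_eval_of_pi hy i).aemeasurable

end Parts

section CarvePolyhedron

variable {Ω : Type*} [MeasurableSpace Ω] {P : Measure Ω} [IsProbabilityMeasure P]
  {n p : ℕ} {X : Matrix (Fin n) (Fin p) ℝ} {g : Fin n → ℝ} {τ : ℝ} {y : Ω → Fin n → ℝ}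
  (hy : HasLaw y (Measure.pi fun i => gaussianReal (g i) (τ ^ 2).toNNReal) P)
include hy

lemma hasLaw_olsCoef {S : Finset (Fin n)} {M : Finset (Fin p)} (h : IsUnit (gram X S M).det)
    (j : M) :
    HasLaw (fun ω => olsCoef X S M j (y ω))
      (gaussianReal (olsCoef X S M j g) (coefVar X τ S M j).toNNReal) P := by
  have hlaw := hasLaw_dotProduct (hasLaw_restrict hy S) (contrast X S M j)
  rwa [Real.coe_toNNReal _ (sq_nonneg τ), ← coefVar_eq_sq_mul_dotProduct h] at hlaw

variable {SA SB : Finset (Fin n)} {M : Finset (Fin p)} {j : M} {m : ℕ} (hτ : τ ≠ 0)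
  (hgramA : IsUnit (gram X SA M).det) (A : Matrix (Fin m) SA ℝ) (b : Fin m → ℝ)
include hτ hgramA

lemma ae_truncLower_lt_truncUpper_contrast :
    ∀ᵐ ω ∂P, SA.restrict (y ω) ∈ polyhedron A b →
      truncLower (contrast X SA M j) A b (SA.restrict (y ω)) <
        truncUpper (contrast X SA M j) A b (SA.restrict (y ω)) :=
  ae_truncLower_lt_truncUpper_of_mem_polyhedron (hasLaw_restrict hy SA)
    (Real.toNNReal_pos.2 (sq_pos_of_ne_zero hτ)).ne' (contrast_dotProduct_contrast_pos hgramA j).ne'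
    A b

lemma hasLawOn_carveCDF (hgramB : IsUnit (gram X SB M).det) (hB : SB.Nonempty)
    (hdisj : Disjoint SA SB) {β : ℝ} (hβA : olsCoef X SA M j g = β)
    (hβB : olsCoef X SB M j g = β) :
    HasLawOn (fun ω => carveCDF X τ SA SB M j
        (truncLower (contrast X SA M j) A b (SA.restrict (y ω)))
        (truncUpper (contrast X SA M j) A b (SA.restrict (y ω))) β
        (carveEstimator X SA SB M j (y ω)))
      (volume.restrict (Set.Ioo 0 1)) P
      ((fun ω => SA.restrict (y ω)) ⁻¹' polyhedron A b) := by
  have hindep : IndepFun (fun ω => SA.restrict (y ω)) (fun ω => olsCoef X SB M j (y ω)) P :=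
    (indepFun_restrict hy hdisj).comp measurable_id (dotProductCLM (contrast X SB M j)).measurable
  have h := hasLawOn_preimage_polyhedron (hasLaw_restrict hy SA)
    (Real.toNNReal_pos.2 (sq_pos_of_ne_zero hτ)).ne' (contrast_dotProduct_contrast_pos hgramA j).ne'
    A b hindep (toNNReal_coefVar_ne_zero hgramB j hτ) (hasLaw_olsCoef hy hgramB j)
    (card_div_pos hB).ne' ((SA.card : ℝ) / n)
  have hmean : (contrast X SA M j ⬝ᵥ fun i : SA => g i) = β := hβA
  have hestimator : ∀ w, carveEstimator X SA SB M j w = (SB.card : ℝ) / n * olsCoef X SB M j w +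
      (SA.card : ℝ) / n * (contrast X SA M j ⬝ᵥ SA.restrict w) := fun w => by
    rw [carveEstimator, ← olsCoef]
    ring
  rw [Real.coe_toNNReal _ (sq_nonneg τ), ← coefVar_eq_sq_mul_dotProduct hgramA, hβB, hmean] at h
  simpa only [carveCDF, hestimator] using h

end CarvePolyhedron

/-! ### Selection events that are unions of disjoint events -/

section Selection

variable {Ω : Type*} [MeasurableSpace Ω] {P : Measure Ω}

lemma preimage_ae_eq_of_absolutelyContinuous {𝓧 : Type*} [MeasurableSpace 𝓧] {ν ν' : Measure 𝓧}
    {u : Ω → 𝓧} (hu : HasLaw u ν P) (hν : ν ≪ ν') {s t : Set 𝓧} (hst : s =ᵐ[ν'] t) :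
    u ⁻¹' s =ᵐ[P] u ⁻¹' t := by
  have h := hν.ae_eq hst
  rw [← hu.map_eq] at h
  exact ae_of_ae_map hu.aemeasurable h

lemma aedisjoint_preimage_of_absolutelyContinuous {𝓧 : Type*} [MeasurableSpace 𝓧]
    {ν ν' : Measure 𝓧} {u : Ω → 𝓧} (hu : HasLaw u ν P) (hν : ν ≪ ν') {s t : Set 𝓧}
    (hst : AEDisjoint ν' s t) : AEDisjoint P (u ⁻¹' s) (u ⁻¹' t) := by
  have h := hν hst
  rw [← hu.map_eq] at h
  exact Measure.preimage_null_of_map_null hu.aemeasurable h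

variable {ι : Type*} [Countable ι] {s : ι → Set Ω}

lemma ae_restrict_index_eq (hs : ∀ i, NullMeasurableSet (s i) P)
    (hd : Pairwise (Function.onFun (AEDisjoint P) s)) {k : Ω → ι}
    (hk : ∀ i, ∀ ω ∈ s i, ω ∈ s (k ω)) (i : ι) : ∀ᵐ ω ∂(P.restrict (s i)), k ω = i := by
  have hnotMem : ∀ᵐ ω ∂P, ∀ l, l ≠ i → ω ∉ s i ∩ s l :=
    ae_all_iff.2 fun l => eventually_imp_distrib_left.2 fun hl =>
      measure_eq_zero_iff_ae_notMem.1 (hd hl.symm)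
  rw [ae_restrict_iff'₀ (hs i)]
  filter_upwards [hnotMem] with ω hω hi
  by_contra hne
  exact hω _ hne ⟨hi, hk i ω hi⟩

variable {E : Set Ω} (hE : E =ᵐ[P] ⋃ i, s i) (hs : ∀ i, NullMeasurableSet (s i) P) {k : Ω → ι}
  (hk : ∀ i, ∀ ω ∈ s i, ω ∈ s (k ω))
include hE hs hk

lemma ae_restrict_of_ae_eq_iUnion {p : ι → Ω → Prop} (hp : ∀ i, ∀ᵐ ω ∂P, ω ∈ s i → p i ω) :
    ∀ᵐ ω ∂(P.restrict E), p (k ω) ω := by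
  rw [Measure.restrict_congr_set hE, ae_restrict_iff'₀ (.iUnion hs)]
  filter_upwards [ae_all_iff.2 hp] with ω hω hmem
  obtain ⟨i, hi⟩ := Set.mem_iUnion.1 hmem
  exact hω _ (hk i ω hi)

lemma hasLawOn_of_ae_eq_iUnion (hd : Pairwise (Function.onFun (AEDisjoint P) s)) {𝓧 : Type*}
    [MeasurableSpace 𝓧] {U : Measure 𝓧} {f : ι → Ω → 𝓧} (hf : ∀ i, HasLawOn (f i) U P (s i)) :
    HasLawOn (fun ω => f (k ω) ω) U P E :=
  (HasLawOn.iUnion hs hd fun i => (hf i).congr <|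
    (ae_restrict_index_eq hs hd hk i).mono fun ω hω => congrArg (f · ω) hω).congr_set hE

end Selection

end Carving

theorem theorem1 {Ω : Type*} [MeasurableSpace Ω] (P : Measure Ω) [IsProbabilityMeasure P]
    {n p : ℕ} (X : Matrix (Fin n) (Fin p) ℝ) (g : Fin n → ℝ) (τ : ℝ) (hτ : 0 < τ)
    -- the response `y ∼ N(g, τ² Iₙ)`
    (y : Ω → Fin n → ℝ)
    (hy : HasLaw y (Measure.pi fun i => gaussianReal (g i) (τ ^ 2).toNNReal) P)
    -- the two parts of the data
    (SA SB : Finset (Fin n)) (hA : SA.Nonempty) (hB : SB.Nonempty)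
    (hdisj : Disjoint SA SB) (hcover : SA ∪ SB = Finset.univ)
    -- the selected model, the coefficient of interest, and well-posed regressions
    (M : Finset (Fin p)) (j : M)
    (hgramA : IsUnit (Carving.gram X SA M).det) (hgramB : IsUnit (Carving.gram X SB M).det)
    -- the selection algorithm, run on part A: selecting `M` is a union of polyhedra
    (Mhat : (SA → ℝ) → Finset (Fin p))
    {ι : Type*} [Countable ι] (m : ι → ℕ)
    (A : ∀ s, Matrix (Fin (m s)) SA ℝ) (b : ∀ s, Fin (m s) → ℝ)
    (hsel : {u | Mhat u = M} =ᵐ[volume] ⋃ s, Carving.polyhedron (A s) (b s))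
    -- the true parameter, the common value of the contrasts of the mean
    (β : ℝ) (hβA : Carving.olsCoef X SA M j g = β) (hβB : Carving.olsCoef X SB M j g = β) :
    -- exact inference given the polyhedron that contains `y_A`
    (∀ s, P {ω | SA.restrict (y ω) ∈ Carving.polyhedron (A s) (b s)} ≠ 0 →
      Carving.ExactInference
        (cond P {ω | SA.restrict (y ω) ∈ Carving.polyhedron (A s) (b s)})
        (Carving.carveCDF X τ SA SB M j)
        (fun ω => Carving.carveEstimator X SA SB M j (y ω))
        (fun ω => Carving.truncLower (Carving.contrast X SA M j) (A s) (b s) (SA.restrict (y ω)))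
        (fun ω => Carving.truncUpper (Carving.contrast X SA M j) (A s) (b s) (SA.restrict (y ω)))
        β) ∧
    -- exact inference given that `M` was selected, with the truncation points of the polyhedron
    -- `shat` that contains `y_A`
    (∀ shat : (SA → ℝ) → ι,
      (∀ u ∈ ⋃ s, Carving.polyhedron (A s) (b s),
        u ∈ Carving.polyhedron (A (shat u)) (b (shat u))) →
      Pairwise (fun s t => AEDisjoint volume
        (Carving.polyhedron (A s) (b s)) (Carving.polyhedron (A t) (b t))) →
      P {ω | Mhat (SA.restrict (y ω)) = M} ≠ 0 →
      Carving.ExactInference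
        (cond P {ω | Mhat (SA.restrict (y ω)) = M})
        (Carving.carveCDF X τ SA SB M j)
        (fun ω => Carving.carveEstimator X SA SB M j (y ω))
        (fun ω => Carving.truncLower (Carving.contrast X SA M j)
          (A (shat (SA.restrict (y ω)))) (b (shat (SA.restrict (y ω)))) (SA.restrict (y ω)))
        (fun ω => Carving.truncUpper (Carving.contrast X SA M j)
          (A (shat (SA.restrict (y ω)))) (b (shat (SA.restrict (y ω)))) (SA.restrict (y ω)))
        β) ∧
    -- the CDF, its strict monotonicity in the common mean, and the roots
    (∀ a₁ b₁ : EReal, a₁ < b₁ → ∀ z : ℝ,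
      (∀ μ : ℝ,
        let σ₁ := √(((SB.card : ℝ) ^ 2 * Carving.coefVar X τ SB M j
          + (SA.card : ℝ) ^ 2 * Carving.coefVar X τ SA M j) / (n : ℝ) ^ 2)
        let σ₂ := √(Carving.coefVar X τ SA M j)
        let ρ := (SA.card : ℝ) / n * σ₂ / σ₁
        let w : EReal := (a₁ - (μ : EReal)) / (σ₂ : EReal)
        let d : EReal := (b₁ - (μ : EReal)) / (σ₂ : EReal)
        Carving.carveCDF X τ SA SB M j a₁ b₁ μ z =
          (Carving.bivariateNormalCDF ρ ((z - μ) / σ₁) d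
            - Carving.bivariateNormalCDF ρ ((z - μ) / σ₁) w)
          / (Carving.stdNormalCDF d - Carving.stdNormalCDF w)) ∧
      StrictAnti (fun μ => Carving.carveCDF X τ SA SB M j a₁ b₁ μ z) ∧
      ∀ α ∈ Set.Ioo (0 : ℝ) 1,
        (∀ μ, Carving.carveCDF X τ SA SB M j a₁ b₁ μ z = 1 - α / 2 ↔
          μ = Carving.ciLower (fun μ' => Carving.carveCDF X τ SA SB M j a₁ b₁ μ' z) α) ∧
        (∀ μ, Carving.carveCDF X τ SA SB M j a₁ b₁ μ z = α / 2 ↔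
          μ = Carving.ciUpper (fun μ' => Carving.carveCDF X τ SA SB M j a₁ b₁ μ' z) α)) := by
  have hyA := Carving.hasLaw_restrict hy SA
  have hac := Carving.pi_gaussianReal_absolutelyContinuous (fun i : SA => g i) fun _ =>
    (Real.toNNReal_pos.2 (pow_pos hτ 2)).ne'
  have hlt := fun s => Carving.ae_truncLower_lt_truncUpper_contrast (j := j) hy hτ.ne' hgramA
    (A s) (b s)
  have hlaw := fun s => Carving.hasLawOn_carveCDF hy hτ.ne' hgramA (A s) (b s) hgramB hB hdisj
    hβA hβB
  have hnull := fun s => hyA.aemeasurable.nullMeasurableSet_preimage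
    (Carving.measurableSet_polyhedron (A s) (b s))
  refine ⟨fun s hs => Carving.exactInference_carveCDF hτ.ne' hB j hgramA hgramB hs
      ((ae_restrict_iff'₀ (hnull s)).2 (hlt s)) (hlaw s),
    fun shat hshat hd hM => ?_, fun a₁ b₁ hab z => ?_⟩
  · have hE := Carving.preimage_ae_eq_of_absolutelyContinuous hyA hac hsel
    rw [Set.preimage_iUnion] at hE
    have hk := fun s ω hω => hshat (SA.restrict (y ω)) (Set.mem_iUnion.2 ⟨s, hω⟩)
    exact Carving.exactInference_carveCDF hτ.ne' hB j hgramA hgramB hM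
      (Carving.ae_restrict_of_ae_eq_iUnion hE hnull hk hlt)
      (Carving.hasLawOn_of_ae_eq_iUnion hE hnull hk (fun s t hst =>
        Carving.aedisjoint_preimage_of_absolutelyContinuous hyA hac (hd hst)) hlaw)
  · have hanti := Carving.strictAnti_carveCDF hτ.ne' hB j hgramA hgramB hab z
    have hrange := Carving.Ioo_subset_range_carveCDF hτ.ne' hB j hgramA hgramB hab z
    exact ⟨fun μ => Carving.carveCDF_eq_bivariateNormalCDF hτ.ne' hB j hgramA hgramB
        hdisj hcover hab.le μ z rfl rfl rfl rfl rfl, hanti,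
      fun α hα => ⟨Carving.eq_ciLower_iff hanti hrange hα, Carving.eq_ciUpper_iff hanti hrange hα⟩⟩
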